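/- Let $k$ be an algebraically closed field. **Conventions.** A $k$-linear category is *finite* if it is equivalent, as a $k$-linear category, to the category of finite-dimensional modules over a finite-dimensional $k$-algebra. A *finite tensor category* is a finite $k$-linear rigid monoidal category whose tensor product is bilinear and whose unit satisfies $\operatorname{End}(\mathbf 1)\cong k$. For an object $c$ of it, the right dual $c^\vee$ comes with an evaluation $c^\vee\otimes c\to\mathbf 1$ and a coevaluation $\mathbf 1\to c\otimes c^\vee$, the left dual ${}^\vee c$ with an evaluation $c\otimes{}^\vee c\to\mathbf 1$ and a coevaluation $\mathbf 1\to{}^\vee c\otimes c$; the functors $c\mapsto{}^{\vee\vee}c$ and $c\mapsto c^{\vee\vee}$ are monoidal in the canonical way. For finite tensor categories $\mathcal A$ and $\mathcal B$, an *$\mathcal A$-$\mathcal B$-bimodule category* is a finite $k$-linear category $\mathcal M$ with bilinear actions $(a,m)\mapsto a.m$ and $(m,b)\mapsto m.b$, exact in $a$ and in $b$ respectively, with natural isomorphisms $(a\otimes a').m\cong a.(a'.m)$, $\mathbf 1.m\cong m$, $m.(b\otimes b')\cong(m.b).b'$, $m.\mathbf 1\cong m$ and $(a.m).b\cong a.(m.b)$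 that satisfy the usual pentagon and triangle relations. A *bimodule functor* $F\colon\mathcal M\to\mathcal N$ is a functor with natural isomorphisms $a.F(m)\cong F(a.m)$ and $F(m).b\cong F(m.b)$ that are compatible with the associativity and unit constraints of the left actions and of the right actions, and for which the two resulting isomorphisms $(a.F(m)).b\to F(a.(m.b))$ coincide. Denote by ${}^{\vee\vee}\mathcal M^{\vee\vee}$ the $\mathcal A$-$\mathcal B$-bimodule category with underlying category $\mathcal M$ on which $a\in\mathcal A$ acts from the left as ${}^{\vee\vee}a$ and $b\in\mathcal B$ acts from the right as $b^{\vee\vee}$. For a finite-dimensional vector space $V$ and $x\in\mathcal M$, let $V\otimes x\in\mathcal M$ be the object that corepresents $\operatorname{Hom}_k(V,\operatorname{Hom}_{\mathcal M}(x,-))$. **Theorem.** Let $\mathcal A$ and $\mathcal B$ be finite tensor categories over $k$ and let $\mathcal M$ be an $\mathcal A$-$\mathcal B$-bimodule category. Then for every $y\in\mathcal M$ the coend $$N^r_{\mathcal M}(y)=\int^{x\in\mathcal M}\operatorname{Hom}_{\mathcal M}(y,x)^*\otimes x$$ exists, the resulting Nakayama functor $N^r_{\mathcal M}\colon\mathcal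 M\to\mathcal M$ is $k$-linear and right exact, and it admits the structure of a bimodule functor $$N^r_{\mathcal M}\colon\ \mathcal M\longrightarrow{}^{\vee\vee}\mathcal M^{\vee\vee}.$$ In particular, there are isomorphisms $N^r_{\mathcal M}(a.m.b)\cong{}^{\vee\vee}a.\,N^r_{\mathcal M}(m)\,.\,b^{\vee\vee}$, natural in $a\in\mathcal A$, $m\in\mathcal M$, $b\in\mathcal B$, and coherent in the sense just described. -/

import Mathlib

open CategoryTheory Limits MonoidalCategory Opposite

/-! ## Finite linear categories -/

/-- A `k`-linear category is *finite* if it is equivalent, by a `k`-linear functor, to the category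
of finite-dimensional left modules over some finite-dimensional `k`-algebra `R`. (As `R` is
finite-dimensional, an `R`-module is finite-dimensional over `k` iff it is finitely generated.) -/
class IsFiniteLinear.{w, v, u} (k : Type w) [Field k] (X : Type u) [Category.{v} X] [Preadditive X]
    [Linear k X] : Prop where
  exists_equivalence : ∃ (R : Type w) (_ : Ring R) (_ : Algebra k R) (_ : Module.Finite k R)
    (e : X ≌ FGModuleCat.{w} R), e.functor.Additive ∧ e.functor.Linear k

section FiniteLinear

universe w v u

variable (k : Type w) [Field k] {X : Type u} [Category.{v} X] [Preadditive X] [Linear k X]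

theorem IsFiniteLinear.hasFiniteBiproducts [IsFiniteLinear k X] : HasFiniteBiproducts X := by
  obtain ⟨R, _, _, _, e, _, _⟩ := IsFiniteLinear.exists_equivalence (k := k) (X := X)
  have : HasFiniteCoproducts X :=
    ⟨fun n => Adjunction.hasColimitsOfShape_of_equivalence e.functor⟩
  exact HasFiniteBiproducts.of_hasFiniteCoproducts

instance IsFiniteLinear.finite_hom [IsFiniteLinear k X] (x y : X) : Module.Finite k (x ⟶ y) := by
  obtain ⟨R, _, _, _, e, _, _⟩ := IsFiniteLinear.exists_equivalence (k := k) (X := X)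
  let _ : Module k (e.functor.obj x) := Module.restrictScalars k R _
  let _ : Module k (e.functor.obj y) := Module.restrictScalars k R _
  have : IsScalarTower k R (e.functor.obj x) := IsScalarTower.restrictScalars k R _
  have : IsScalarTower k R (e.functor.obj y) := IsScalarTower.restrictScalars k R _
  have : Module.Finite k (e.functor.obj x) := Module.Finite.trans R _
  have : Module.Finite k (e.functor.obj y) := Module.Finite.trans R _
  let φ : (x ⟶ y) →ₗ[k] (e.functor.obj x →ₗ[k] e.functor.obj y) :=
    { toFun := fun f => (e.functor.map f).hom.hom.restrictScalars k
      map_add' := fun f g => by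
        rw [CategoryTheory.Functor.map_add]; rfl
      map_smul' := fun c f => by
        rw [CategoryTheory.Functor.map_smul]; rfl }
  refine Module.Finite.of_injective φ ?_
  intro f g h
  apply e.functor.map_injective
  apply FGModuleCat.hom_ext
  ext v
  exact LinearMap.congr_fun h v

end FiniteLinear

/-! ## Tensoring objects with finite-dimensional vector spaces -/

section Copower

universe w v u w₁ w₂ w₃

variable (k : Type w) [Field k] {X : Type u} [Category.{v} X] [Preadditive X] [Linear k X]
  [IsFiniteLinear k X]
variable (V : Type w₁) [AddCommGroup V] [Module k V] [Module.Finite k V]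
variable (V' : Type w₂) [AddCommGroup V'] [Module k V'] [Module.Finite k V']

/-- The object `V ⊗ x`, for a finite-dimensional vector space `V` and an object `x` of a finite
linear category, realized as a direct sum of `dim V` copies of `x`. -/
noncomputable def copower (x : X) : X :=
  haveI : HasFiniteBiproducts X := IsFiniteLinear.hasFiniteBiproducts k
  ⨁ fun _ : Fin (Module.finrank k V) => x

/-- The defining property of `V ⊗ x`: it corepresents the functor `Hom_k(V, Hom(x, -))`. -/
noncomputable def copowerHomEquiv (x y : X) : (copower k V x ⟶ y) ≃ₗ[k] (V →ₗ[k] (x ⟶ y)) :=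
  haveI : HasFiniteBiproducts X := IsFiniteLinear.hasFiniteBiproducts k
  LinearEquiv.trans
    { toFun := fun f j => biproduct.ι (fun _ : Fin (Module.finrank k V) => x) j ≫ f
      invFun := fun p => biproduct.desc p
      map_add' := fun f g => funext fun j => Preadditive.comp_add _ _ _ _ f g
      map_smul' := fun c f => funext fun j => Linear.comp_smul _ _ _ _ c f
      left_inv := fun f => by
        apply biproduct.hom_ext'
        intro j
        simp
      right_inv := fun p => by ext j; simp }
    ((Module.finBasis k V).constr k)

/-- The universal linear map `V → Hom(x, V ⊗ x)`. -/
noncomputable def copowerUnit (x : X) : V →ₗ[k] (x ⟶ copower k V x) :=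
  copowerHomEquiv k V x _ (𝟙 _)

theorem copowerHomEquiv_apply {x y : X} (f : copower k V x ⟶ y) (v : V) :
    copowerHomEquiv k V x y f v = copowerUnit k V x v ≫ f := by
  have : HasFiniteBiproducts X := IsFiniteLinear.hasFiniteBiproducts k
  have h : copowerHomEquiv k V x y f =
      (Linear.rightComp k x f).comp (copowerHomEquiv k V x _ (𝟙 _)) := by
    apply (Module.finBasis k V).ext
    intro j
    simp only [copowerHomEquiv, LinearEquiv.trans_apply, Module.Basis.constr_basis,
      LinearMap.comp_apply, Linear.rightComp_apply]
    change biproduct.ι _ j ≫ f = (biproduct.ι _ j ≫ 𝟙 _) ≫ f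
    rw [Category.comp_id]
  exact LinearMap.congr_fun h v

variable {V} {V'}

theorem copower_hom_ext {x y : X} {f g : copower k V x ⟶ y}
    (h : ∀ v, copowerUnit k V x v ≫ f = copowerUnit k V x v ≫ g) : f = g := by
  apply (copowerHomEquiv k V x y).injective
  ext v
  simp [copowerHomEquiv_apply, h]

/-- The morphism `φ ⊗ f : V ⊗ x ⟶ V' ⊗ x'`. -/
noncomputable def copowerMap (φ : V →ₗ[k] V') {x x' : X} (f : x ⟶ x') :
    copower k V x ⟶ copower k V' x' :=
  (copowerHomEquiv k V x _).symm ((Linear.leftComp k _ f).comp ((copowerUnit k V' x').comp φ))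

theorem copowerUnit_map (φ : V →ₗ[k] V') {x x' : X} (f : x ⟶ x') (v : V) :
    copowerUnit k V x v ≫ copowerMap k φ f = f ≫ copowerUnit k V' x' (φ v) := by
  rw [← copowerHomEquiv_apply, copowerMap, LinearEquiv.apply_symm_apply]
  rfl

theorem copowerUnit_map_assoc (φ : V →ₗ[k] V') {x x' y : X} (f : x ⟶ x') (v : V)
    (h : copower k V' x' ⟶ y) :
    copowerUnit k V x v ≫ copowerMap k φ f ≫ h = f ≫ copowerUnit k V' x' (φ v) ≫ h := by
  rw [← Category.assoc, copowerUnit_map, Category.assoc]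

theorem copowerMap_id (x : X) : copowerMap k (LinearMap.id : V →ₗ[k] V) (𝟙 x) = 𝟙 _ := by
  apply copower_hom_ext
  intro v
  simp [copowerUnit_map]

theorem copowerMap_comp {V'' : Type w₃} [AddCommGroup V''] [Module k V''] [Module.Finite k V'']
    (φ : V →ₗ[k] V') (ψ : V' →ₗ[k] V'') {x x' x'' : X} (f : x ⟶ x') (g : x' ⟶ x'') :
    copowerMap k (ψ.comp φ) (f ≫ g) = copowerMap k φ f ≫ copowerMap k ψ g := by
  apply copower_hom_ext
  intro v
  simp [copowerUnit_map, copowerUnit_map_assoc]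

end Copower

/-! ## The Nakayama functor -/

section Nakayama

universe w v u

variable (k : Type w) [Field k] (X : Type u) [Category.{v} X] [Preadditive X] [Linear k X]

/-- The dual Hom functor `(y, x') ↦ Hom(y, x')^*` on morphisms: the linear map
`Hom(y, x')^* → Hom(z, x)^*` induced by `f : y ⟶ z` and `g : x ⟶ x'`. -/
def dualHomMap {X} [Category.{v} X] [Preadditive X] [Linear k X] {y z x x' : X} (f : y ⟶ z)
    (g : x ⟶ x') : Module.Dual k (y ⟶ x') →ₗ[k] Module.Dual k (z ⟶ x) :=
  Module.Dual.transpose (R := k) ((Linear.rightComp k y g).comp (Linear.leftComp k x f))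

@[simp]
theorem dualHomMap_apply {X} [Category.{v} X] [Preadditive X] [Linear k X] {y z x x' : X}
    (f : y ⟶ z) (g : x ⟶ x') (ξ : Module.Dual k (y ⟶ x')) (h : z ⟶ x) :
    dualHomMap k f g ξ h = ξ (f ≫ h ≫ g) := by
  change ξ ((f ≫ h) ≫ g) = _
  rw [Category.assoc]

variable [IsFiniteLinear k X]

/-- The integrand `(y, x', x) ↦ Hom(y, x')^* ⊗ x` of the coend that defines the Nakayama
functor. -/
noncomputable def nakayamaIntegrand : X ⥤ Xᵒᵖ ⥤ X ⥤ X where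
  obj y :=
    { obj x' :=
        { obj x := copower k (Module.Dual k (y ⟶ x'.unop)) x
          map f := copowerMap k LinearMap.id f
          map_id x := copowerMap_id k x
          map_comp f g := by
            rw [← copowerMap_comp, LinearMap.comp_id] }
      map g :=
        { app x := copowerMap k (dualHomMap k (𝟙 y) g.unop) (𝟙 x)
          naturality x₁ x₂ f := by
            dsimp only
            rw [← copowerMap_comp, ← copowerMap_comp]
            simp }
      map_id x' := by
        ext x
        apply copower_hom_ext
        intro v
        simp only [copowerUnit_map]
        have : dualHomMap k (𝟙 y) (𝟙 x'.unop) v = v := by ext; simp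
        simp [this]
      map_comp g₁ g₂ := by
        ext x
        apply copower_hom_ext
        intro v
        have : dualHomMap k (𝟙 y) (g₂.unop ≫ g₁.unop) v =
          dualHomMap k (𝟙 y) g₂.unop (dualHomMap k (𝟙 y) g₁.unop v) := by ext; simp
        simp [copowerUnit_map, copowerUnit_map_assoc, this] }
  map f :=
    { app x' :=
        { app x := copowerMap k (dualHomMap k f (𝟙 x'.unop)) (𝟙 x)
          naturality x₁ x₂ g := by
            dsimp only
            rw [← copowerMap_comp, ← copowerMap_comp]
            simp }
      naturality x₁ x₂ g := by
        ext x
        apply copower_hom_ext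
        intro v
        have : dualHomMap k f (𝟙 x₂.unop) (dualHomMap k (𝟙 _) g.unop v) =
          dualHomMap k (𝟙 _) g.unop (dualHomMap k f (𝟙 x₁.unop) v) := by ext; simp
        simp [copowerUnit_map, copowerUnit_map_assoc, this] }
  map_id y := by
    ext x' x
    apply copower_hom_ext
    intro v
    have : dualHomMap k (𝟙 y) (𝟙 x'.unop) v = v := by ext; simp
    simp [copowerUnit_map, this]
  map_comp f g := by
    ext x' x
    apply copower_hom_ext
    intro v
    have : dualHomMap k (f ≫ g) (𝟙 x'.unop) v =
      dualHomMap k g (𝟙 x'.unop) (dualHomMap k f (𝟙 x'.unop) v) := by ext; simp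
    simp [copowerUnit_map, copowerUnit_map_assoc, this]

/-- The Nakayama functor `y ↦ ∫^x Hom(y, x)^* ⊗ x`. -/
noncomputable def nakayamaFunctor [∀ y : X, HasCoend ((nakayamaIntegrand k X).obj y)] : X ⥤ X where
  obj y := coend ((nakayamaIntegrand k X).obj y)
  map f := coend.map ((nakayamaIntegrand k X).map f)
  map_id y := by rw [CategoryTheory.Functor.map_id]; exact coend.map_id
  map_comp f g := by rw [CategoryTheory.Functor.map_comp]; exact (coend.map_comp _ _).symm

end Nakayama

/-! ## Duals of morphisms with respect to given pairings -/

section Mates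

universe v u

variable {C : Type u} [Category.{v} C] [MonoidalCategory C]

/-- The morphism `ᘁf : ᘁY ⟶ ᘁX` dual to `f : X ⟶ Y`, for given left duals `X'` of `X` and
`Y'` of `Y`. -/
def leftMate (X' Y' : C) {X Y : C} [ExactPairing X' X] [ExactPairing Y' Y] (f : X ⟶ Y) : Y' ⟶ X' :=
  letI : HasLeftDual X := ⟨X'⟩
  letI : HasLeftDual Y := ⟨Y'⟩
  leftAdjointMate f

/-- The morphism `fᘁ : Yᘁ ⟶ Xᘁ` dual to `f : X ⟶ Y`, for given right duals `X'` of `X` and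
`Y'` of `Y`. -/
def rightMate (X' Y' : C) {X Y : C} [ExactPairing X X'] [ExactPairing Y Y'] (f : X ⟶ Y) : Y' ⟶ X' :=
  letI : HasRightDual X := ⟨X'⟩
  letI : HasRightDual Y := ⟨Y'⟩
  rightAdjointMate f

theorem leftMate_evaluation (X' Y' : C) {X Y : C} [ExactPairing X' X] [ExactPairing Y' Y]
    (f : X ⟶ Y) : X ◁ leftMate X' Y' f ≫ ε_ X' X = f ▷ Y' ≫ ε_ Y' Y :=
  letI : HasLeftDual X := ⟨X'⟩
  letI : HasLeftDual Y := ⟨Y'⟩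
  leftAdjointMate_comp_evaluation f

theorem leftMate_eq {X' Y' X Y : C} [ExactPairing X' X] [ExactPairing Y' Y]
    {f : X ⟶ Y} {g : Y' ⟶ X'} (h : X ◁ g ≫ ε_ X' X = f ▷ Y' ≫ ε_ Y' Y) : leftMate X' Y' f = g := by
  have h' := h.trans (leftMate_evaluation X' Y' f).symm
  let _ : HasLeftDual X := ⟨X'⟩
  have e := congrArg (tensorLeftHomEquiv Y' X' X (𝟙_ C)) h'
  have e₁ : (tensorLeftHomEquiv Y' X' X (𝟙_ C)) (X ◁ g ≫ ε_ X' X) = g ≫ (ρ_ X').inv :=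
    tensorLeftHomEquiv_whiskerLeft_comp_evaluation (Z := X) g
  have e₂ : (tensorLeftHomEquiv Y' X' X (𝟙_ C)) (X ◁ leftMate X' Y' f ≫ ε_ X' X) =
      leftMate X' Y' f ≫ (ρ_ X').inv :=
    tensorLeftHomEquiv_whiskerLeft_comp_evaluation (Z := X) (leftMate X' Y' f)
  rw [e₁, e₂] at e
  exact ((cancel_mono _).1 e).symm

theorem leftMate_id (X' : C) {X : C} [ExactPairing X' X] : leftMate X' X' (𝟙 X) = 𝟙 X' :=
  leftMate_eq (by simp)

theorem leftMate_comp (X' Y' Z' : C) {X Y Z : C} [ExactPairing X' X] [ExactPairing Y' Y]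
    [ExactPairing Z' Z] (f : X ⟶ Y) (g : Y ⟶ Z) :
    leftMate X' Z' (f ≫ g) = leftMate Y' Z' g ≫ leftMate X' Y' f :=
  letI : HasLeftDual X := ⟨X'⟩
  letI : HasLeftDual Y := ⟨Y'⟩
  letI : HasLeftDual Z := ⟨Z'⟩
  comp_leftAdjointMate

theorem leftMate_tensor (X₁' Y₁' X₂' Y₂' : C) {X₁ Y₁ X₂ Y₂ : C} [ExactPairing X₁' X₁]
    [ExactPairing Y₁' Y₁] [ExactPairing X₂' X₂] [ExactPairing Y₂' Y₂]
    (f₁ : X₁ ⟶ Y₁) (f₂ : X₂ ⟶ Y₂) :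
    leftMate (X₂' ⊗ X₁') (Y₂' ⊗ Y₁') (f₁ ⊗ₘ f₂) = leftMate X₂' Y₂' f₂ ⊗ₘ leftMate X₁' Y₁' f₁ := by
  apply leftMate_eq
  simp only [ExactPairing.tensor_evaluation]
  have h₁ := leftMate_evaluation X₁' Y₁' f₁
  have h₂ := leftMate_evaluation X₂' Y₂' f₂
  generalize leftMate X₁' Y₁' f₁ = g₁ at *
  generalize leftMate X₂' Y₂' f₂ = g₂ at *
  calc
    _ = 𝟙 _ ⊗≫ X₁ ◁ X₂ ◁ g₂ ▷ Y₁' ⊗≫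
        X₁ ◁ ((X₂ ⊗ X₂') ◁ g₁ ≫ ε_ X₂' X₂ ▷ X₁') ⊗≫ ε_ X₁' X₁ := by
      rw [MonoidalCategory.tensorHom_def]
      monoidal
    _ = 𝟙 _ ⊗≫ X₁ ◁ (X₂ ◁ g₂ ≫ ε_ X₂' X₂) ▷ Y₁' ⊗≫ (X₁ ◁ g₁ ≫ ε_ X₁' X₁) := by
      rw [whisker_exchange]
      monoidal
    _ = 𝟙 _ ⊗≫ X₁ ◁ f₂ ▷ (Y₂' ⊗ Y₁') ⊗≫
        (X₁ ◁ (ε_ Y₂' Y₂ ▷ Y₁') ≫ f₁ ▷ (𝟙_ C ⊗ Y₁')) ⊗≫ ε_ Y₁' Y₁ := by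
      rw [h₁, h₂]
      monoidal
    _ = _ := by
      rw [whisker_exchange, MonoidalCategory.tensorHom_def']
      monoidal

theorem leftMate_associator (X' Y' Z' : C) {X Y Z : C} [ExactPairing X' X] [ExactPairing Y' Y]
    [ExactPairing Z' Z] :
    leftMate (Z' ⊗ (Y' ⊗ X')) ((Z' ⊗ Y') ⊗ X') (α_ X Y Z).hom = (α_ Z' Y' X').hom := by
  apply leftMate_eq
  simp only [ExactPairing.tensor_evaluation]
  monoidal

theorem leftMate_leftUnitor (X' : C) {X : C} [ExactPairing X' X] :
    leftMate (X' ⊗ 𝟙_ C) X' (λ_ X).hom = (ρ_ X').inv := by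
  apply leftMate_eq
  simp only [ExactPairing.tensor_evaluation]
  have : ε_ (𝟙_ C) (𝟙_ C) = (ρ_ (𝟙_ C)).hom := rfl
  rw [this]
  monoidal

theorem leftMate_rightUnitor (X' : C) {X : C} [ExactPairing X' X] :
    leftMate (𝟙_ C ⊗ X') X' (ρ_ X).hom = (λ_ X').inv := by
  apply leftMate_eq
  simp only [ExactPairing.tensor_evaluation]
  have : ε_ (𝟙_ C) (𝟙_ C) = (ρ_ (𝟙_ C)).hom := rfl
  rw [this]
  monoidal

theorem leftMate_rightMate (X' Y' : C) {X Y : C} [ExactPairing X X'] [ExactPairing Y Y']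
    (f : X ⟶ Y) : leftMate Y X (rightMate X' Y' f) = f :=
  letI : HasRightDual X := ⟨X'⟩
  letI : HasRightDual Y := ⟨Y'⟩
  leftMate_eq (rightAdjointMate_comp_evaluation f).symm

theorem leftMate_injective {X' Y' X Y : C} [ExactPairing X' X] [ExactPairing Y' Y]
    {f g : X ⟶ Y} (h : leftMate X' Y' f = leftMate X' Y' g) : f = g := by
  have h' : f ▷ Y' ≫ ε_ Y' Y = g ▷ Y' ≫ ε_ Y' Y := by
    rw [← leftMate_evaluation X', ← leftMate_evaluation X', h]
  let _ : HasRightDual Y' := ⟨Y⟩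
  have e := congrArg (tensorRightHomEquiv X Y' Y (𝟙_ C)) h'
  have e₁ (t : X ⟶ Y) : (tensorRightHomEquiv X Y' Y (𝟙_ C)) (t ▷ Y' ≫ ε_ Y' Y) = t ≫ (λ_ Y).inv :=
    tensorRightHomEquiv_whiskerRight_comp_evaluation (X := Y') t
  rw [e₁, e₁] at e
  exact (cancel_mono _).1 e

theorem rightMate_eq {X' Y' X Y : C} [ExactPairing X X'] [ExactPairing Y Y']
    {f : X ⟶ Y} {g : Y' ⟶ X'} (h : leftMate Y X g = f) : rightMate X' Y' f = g :=
  leftMate_injective ((leftMate_rightMate X' Y' f).trans h.symm)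

theorem rightMate_id (X' : C) {X : C} [ExactPairing X X'] : rightMate X' X' (𝟙 X) = 𝟙 X' :=
  rightMate_eq (leftMate_id X)

theorem rightMate_comp (X' Y' Z' : C) {X Y Z : C} [ExactPairing X X'] [ExactPairing Y Y']
    [ExactPairing Z Z'] (f : X ⟶ Y) (g : Y ⟶ Z) :
    rightMate X' Z' (f ≫ g) = rightMate Y' Z' g ≫ rightMate X' Y' f :=
  rightMate_eq (by rw [leftMate_comp Z Y X, leftMate_rightMate, leftMate_rightMate])

theorem rightMate_tensor (X₁' Y₁' X₂' Y₂' : C) {X₁ Y₁ X₂ Y₂ : C} [ExactPairing X₁ X₁']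
    [ExactPairing Y₁ Y₁'] [ExactPairing X₂ X₂'] [ExactPairing Y₂ Y₂']
    (f₁ : X₁ ⟶ Y₁) (f₂ : X₂ ⟶ Y₂) :
    rightMate (X₂' ⊗ X₁') (Y₂' ⊗ Y₁') (f₁ ⊗ₘ f₂) =
      rightMate X₂' Y₂' f₂ ⊗ₘ rightMate X₁' Y₁' f₁ :=
  rightMate_eq (by rw [leftMate_tensor, leftMate_rightMate, leftMate_rightMate])

theorem rightMate_associator (X' Y' Z' : C) {X Y Z : C} [ExactPairing X X'] [ExactPairing Y Y']
    [ExactPairing Z Z'] :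
    rightMate (Z' ⊗ (Y' ⊗ X')) ((Z' ⊗ Y') ⊗ X') (α_ X Y Z).hom = (α_ Z' Y' X').hom :=
  rightMate_eq (leftMate_associator Z Y X)

theorem rightMate_leftUnitor (X' : C) {X : C} [ExactPairing X X'] :
    rightMate (X' ⊗ 𝟙_ C) X' (λ_ X).hom = (ρ_ X').inv := by
  rw [← cancel_mono (ρ_ X').hom, Iso.inv_hom_id]
  rw [← rightMate_eq (leftMate_rightUnitor X), ← rightMate_comp]
  simp [rightMate_id]

theorem rightMate_rightUnitor (X' : C) {X : C} [ExactPairing X X'] :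
    rightMate (𝟙_ C ⊗ X') X' (ρ_ X).hom = (λ_ X').inv := by
  rw [← cancel_mono (λ_ X').hom, Iso.inv_hom_id]
  rw [← rightMate_eq (leftMate_leftUnitor X), ← rightMate_comp]
  simp [rightMate_id]

end Mates

/-! ## The double dual functors -/

section DoubleDual

universe v u

variable {C : Type u} [Category.{v} C] [MonoidalCategory C]

/-- The left dual `ᘁX` of an object of a left rigid monoidal category. -/
def leftDualObj [LeftRigidCategory C] (X : C) : C :=
  (LeftRigidCategory.leftDual X).leftDual

instance [LeftRigidCategory C] (X : C) : ExactPairing (leftDualObj X) X :=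
  (LeftRigidCategory.leftDual X).exact

/-- The right dual `Xᘁ` of an object of a right rigid monoidal category. -/
def rightDualObj [RightRigidCategory C] (X : C) : C :=
  (RightRigidCategory.rightDual X).rightDual

instance [RightRigidCategory C] (X : C) : ExactPairing X (rightDualObj X) :=
  (RightRigidCategory.rightDual X).exact

variable (C)

/-- The double left dual functor `X ↦ ᘁᘁX` of a left rigid monoidal category. -/
def leftDoubleDual [LeftRigidCategory C] : C ⥤ C where
  obj X := leftDualObj (leftDualObj X)
  map {X Y} f := leftMate (leftDualObj (leftDualObj Y)) (leftDualObj (leftDualObj X))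
    (leftMate (leftDualObj X) (leftDualObj Y) f)
  map_id X := by rw [leftMate_id, leftMate_id]
  map_comp {X Y Z} f g := by
    rw [leftMate_comp (leftDualObj X) (leftDualObj Y), leftMate_comp _ (leftDualObj (leftDualObj Y))]

/-- The double right dual functor `X ↦ Xᘁᘁ` of a right rigid monoidal category. -/
def rightDoubleDual [RightRigidCategory C] : C ⥤ C where
  obj X := rightDualObj (rightDualObj X)
  map {X Y} f := rightMate (rightDualObj (rightDualObj Y)) (rightDualObj (rightDualObj X))
    (rightMate (rightDualObj X) (rightDualObj Y) f)
  map_id X := by rw [rightMate_id, rightMate_id]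
  map_comp {X Y Z} f g := by
    rw [rightMate_comp (rightDualObj X) (rightDualObj Y),
      rightMate_comp _ (rightDualObj (rightDualObj Y))]

variable {C}

/-- The morphism `X₂ ⟶ Y₂` of double left duals induced by `f : X ⟶ Y`, where `X₂` is a left dual
of a left dual `X₁` of `X`, and `Y₂` is a left dual of a left dual `Y₁` of `Y`. -/
def leftMate₂ (X₂ X₁ Y₂ Y₁ : C) {X Y : C} [ExactPairing X₂ X₁] [ExactPairing X₁ X]
    [ExactPairing Y₂ Y₁] [ExactPairing Y₁ Y] (f : X ⟶ Y) : X₂ ⟶ Y₂ :=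
  leftMate Y₂ X₂ (leftMate X₁ Y₁ f)

/-- The morphism `X₂ ⟶ Y₂` of double right duals induced by `f : X ⟶ Y`, where `X₂` is a right dual
of a right dual `X₁` of `X`, and `Y₂` is a right dual of a right dual `Y₁` of `Y`. -/
def rightMate₂ (X₂ X₁ Y₂ Y₁ : C) {X Y : C} [ExactPairing X₁ X₂] [ExactPairing X X₁]
    [ExactPairing Y₁ Y₂] [ExactPairing Y Y₁] (f : X ⟶ Y) : X₂ ⟶ Y₂ :=
  rightMate Y₂ X₂ (rightMate X₁ Y₁ f)

theorem leftMate₂_id (X₂ X₁ : C) {X : C} [ExactPairing X₂ X₁] [ExactPairing X₁ X] :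
    leftMate₂ X₂ X₁ X₂ X₁ (𝟙 X) = 𝟙 X₂ := by
  rw [leftMate₂, leftMate_id, leftMate_id]

theorem rightMate₂_id (X₂ X₁ : C) {X : C} [ExactPairing X₁ X₂] [ExactPairing X X₁] :
    rightMate₂ X₂ X₁ X₂ X₁ (𝟙 X) = 𝟙 X₂ := by
  rw [rightMate₂, rightMate_id, rightMate_id]

theorem leftMate₂_comp (X₂ X₁ Y₂ Y₁ Z₂ Z₁ : C) {X Y Z : C} [ExactPairing X₂ X₁] [ExactPairing X₁ X]
    [ExactPairing Y₂ Y₁] [ExactPairing Y₁ Y] [ExactPairing Z₂ Z₁] [ExactPairing Z₁ Z]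
    (f : X ⟶ Y) (g : Y ⟶ Z) :
    leftMate₂ X₂ X₁ Y₂ Y₁ f ≫ leftMate₂ Y₂ Y₁ Z₂ Z₁ g = leftMate₂ X₂ X₁ Z₂ Z₁ (f ≫ g) := by
  rw [leftMate₂, leftMate₂, leftMate₂, leftMate_comp X₁ Y₁ Z₁, leftMate_comp Z₂ Y₂ X₂]

theorem rightMate₂_comp (X₂ X₁ Y₂ Y₁ Z₂ Z₁ : C) {X Y Z : C} [ExactPairing X₁ X₂]
    [ExactPairing X X₁] [ExactPairing Y₁ Y₂] [ExactPairing Y Y₁] [ExactPairing Z₁ Z₂]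
    [ExactPairing Z Z₁] (f : X ⟶ Y) (g : Y ⟶ Z) :
    rightMate₂ X₂ X₁ Y₂ Y₁ f ≫ rightMate₂ Y₂ Y₁ Z₂ Z₁ g = rightMate₂ X₂ X₁ Z₂ Z₁ (f ≫ g) := by
  rw [rightMate₂, rightMate₂, rightMate₂, rightMate_comp X₁ Y₁ Z₁, rightMate_comp Z₂ Y₂ X₂]

theorem leftMate₂_tensor (X₂ X₁ Y₂ Y₁ V₂ V₁ W₂ W₁ : C) {X Y V W : C}
    [ExactPairing X₂ X₁] [ExactPairing X₁ X] [ExactPairing Y₂ Y₁] [ExactPairing Y₁ Y]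
    [ExactPairing V₂ V₁] [ExactPairing V₁ V] [ExactPairing W₂ W₁] [ExactPairing W₁ W]
    (f : X ⟶ Y) (g : V ⟶ W) :
    leftMate₂ (X₂ ⊗ V₂) (V₁ ⊗ X₁) (Y₂ ⊗ W₂) (W₁ ⊗ Y₁) (f ⊗ₘ g) =
      leftMate₂ X₂ X₁ Y₂ Y₁ f ⊗ₘ leftMate₂ V₂ V₁ W₂ W₁ g := by
  rw [leftMate₂, leftMate_tensor, leftMate_tensor]; rfl

theorem rightMate₂_tensor (X₂ X₁ Y₂ Y₁ V₂ V₁ W₂ W₁ : C) {X Y V W : C}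
    [ExactPairing X₁ X₂] [ExactPairing X X₁] [ExactPairing Y₁ Y₂] [ExactPairing Y Y₁]
    [ExactPairing V₁ V₂] [ExactPairing V V₁] [ExactPairing W₁ W₂] [ExactPairing W W₁]
    (f : X ⟶ Y) (g : V ⟶ W) :
    rightMate₂ (X₂ ⊗ V₂) (V₁ ⊗ X₁) (Y₂ ⊗ W₂) (W₁ ⊗ Y₁) (f ⊗ₘ g) =
      rightMate₂ X₂ X₁ Y₂ Y₁ f ⊗ₘ rightMate₂ V₂ V₁ W₂ W₁ g := by
  rw [rightMate₂, rightMate_tensor, rightMate_tensor]; rfl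

theorem leftMate₂_associator (X₂ X₁ Y₂ Y₁ Z₂ Z₁ : C) {X Y Z : C} [ExactPairing X₂ X₁]
    [ExactPairing X₁ X] [ExactPairing Y₂ Y₁] [ExactPairing Y₁ Y] [ExactPairing Z₂ Z₁]
    [ExactPairing Z₁ Z] :
    leftMate₂ ((X₂ ⊗ Y₂) ⊗ Z₂) (Z₁ ⊗ (Y₁ ⊗ X₁)) (X₂ ⊗ (Y₂ ⊗ Z₂)) ((Z₁ ⊗ Y₁) ⊗ X₁) (α_ X Y Z).hom =
      (α_ X₂ Y₂ Z₂).hom := by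
  rw [leftMate₂, leftMate_associator, leftMate_associator]

theorem rightMate₂_associator (X₂ X₁ Y₂ Y₁ Z₂ Z₁ : C) {X Y Z : C} [ExactPairing X₁ X₂]
    [ExactPairing X X₁] [ExactPairing Y₁ Y₂] [ExactPairing Y Y₁] [ExactPairing Z₁ Z₂]
    [ExactPairing Z Z₁] :
    rightMate₂ ((X₂ ⊗ Y₂) ⊗ Z₂) (Z₁ ⊗ (Y₁ ⊗ X₁)) (X₂ ⊗ (Y₂ ⊗ Z₂)) ((Z₁ ⊗ Y₁) ⊗ X₁) (α_ X Y Z).hom =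
      (α_ X₂ Y₂ Z₂).hom := by
  rw [rightMate₂, rightMate_associator, rightMate_associator]

theorem leftMate₂_leftUnitor (X₂ X₁ : C) {X : C} [ExactPairing X₂ X₁] [ExactPairing X₁ X] :
    leftMate₂ (𝟙_ C ⊗ X₂) (X₁ ⊗ 𝟙_ C) X₂ X₁ (λ_ X).hom = (λ_ X₂).hom := by
  rw [leftMate₂, leftMate_leftUnitor, ← cancel_mono (λ_ X₂).inv, Iso.hom_inv_id,
    ← leftMate_rightUnitor X₂ (X := X₁), ← leftMate_comp, Iso.hom_inv_id, leftMate_id]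

theorem rightMate₂_leftUnitor (X₂ X₁ : C) {X : C} [ExactPairing X₁ X₂] [ExactPairing X X₁] :
    rightMate₂ (𝟙_ C ⊗ X₂) (X₁ ⊗ 𝟙_ C) X₂ X₁ (λ_ X).hom = (λ_ X₂).hom := by
  rw [rightMate₂, rightMate_leftUnitor, ← cancel_mono (λ_ X₂).inv, Iso.hom_inv_id,
    ← rightMate_rightUnitor X₂ (X := X₁), ← rightMate_comp, Iso.hom_inv_id, rightMate_id]

theorem leftMate₂_rightUnitor (X₂ X₁ : C) {X : C} [ExactPairing X₂ X₁] [ExactPairing X₁ X] :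
    leftMate₂ (X₂ ⊗ 𝟙_ C) (𝟙_ C ⊗ X₁) X₂ X₁ (ρ_ X).hom = (ρ_ X₂).hom := by
  rw [leftMate₂, leftMate_rightUnitor, ← cancel_mono (ρ_ X₂).inv, Iso.hom_inv_id,
    ← leftMate_leftUnitor X₂ (X := X₁), ← leftMate_comp, Iso.hom_inv_id, leftMate_id]

theorem rightMate₂_rightUnitor (X₂ X₁ : C) {X : C} [ExactPairing X₁ X₂] [ExactPairing X X₁] :
    rightMate₂ (X₂ ⊗ 𝟙_ C) (𝟙_ C ⊗ X₁) X₂ X₁ (ρ_ X).hom = (ρ_ X₂).hom := by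
  rw [rightMate₂, rightMate_rightUnitor, ← cancel_mono (ρ_ X₂).inv, Iso.hom_inv_id,
    ← rightMate_leftUnitor X₂ (X := X₁), ← rightMate_comp, Iso.hom_inv_id, rightMate_id]

theorem leftMate₂_whiskerRight (X₂ X₁ Y₂ Y₁ V₂ V₁ : C) {X Y V : C}
    [ExactPairing X₂ X₁] [ExactPairing X₁ X] [ExactPairing Y₂ Y₁] [ExactPairing Y₁ Y]
    [ExactPairing V₂ V₁] [ExactPairing V₁ V] (f : X ⟶ Y) :
    leftMate₂ X₂ X₁ Y₂ Y₁ f ▷ V₂ =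
      leftMate₂ (X₂ ⊗ V₂) (V₁ ⊗ X₁) (Y₂ ⊗ V₂) (V₁ ⊗ Y₁) (f ▷ V) := by
  rw [← MonoidalCategory.tensorHom_id, ← MonoidalCategory.tensorHom_id, leftMate₂_tensor,
    leftMate₂_id]

theorem leftMate₂_whiskerLeft (X₂ X₁ Y₂ Y₁ V₂ V₁ : C) {X Y V : C}
    [ExactPairing X₂ X₁] [ExactPairing X₁ X] [ExactPairing Y₂ Y₁] [ExactPairing Y₁ Y]
    [ExactPairing V₂ V₁] [ExactPairing V₁ V] (f : X ⟶ Y) :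
    V₂ ◁ leftMate₂ X₂ X₁ Y₂ Y₁ f =
      leftMate₂ (V₂ ⊗ X₂) (X₁ ⊗ V₁) (V₂ ⊗ Y₂) (Y₁ ⊗ V₁) (V ◁ f) := by
  rw [← MonoidalCategory.id_tensorHom, ← MonoidalCategory.id_tensorHom, leftMate₂_tensor,
    leftMate₂_id]

theorem rightMate₂_whiskerRight (X₂ X₁ Y₂ Y₁ V₂ V₁ : C) {X Y V : C}
    [ExactPairing X₁ X₂] [ExactPairing X X₁] [ExactPairing Y₁ Y₂] [ExactPairing Y Y₁]
    [ExactPairing V₁ V₂] [ExactPairing V V₁] (f : X ⟶ Y) :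
    rightMate₂ X₂ X₁ Y₂ Y₁ f ▷ V₂ =
      rightMate₂ (X₂ ⊗ V₂) (V₁ ⊗ X₁) (Y₂ ⊗ V₂) (V₁ ⊗ Y₁) (f ▷ V) := by
  rw [← MonoidalCategory.tensorHom_id, ← MonoidalCategory.tensorHom_id, rightMate₂_tensor,
    rightMate₂_id]

theorem rightMate₂_whiskerLeft (X₂ X₁ Y₂ Y₁ V₂ V₁ : C) {X Y V : C}
    [ExactPairing X₁ X₂] [ExactPairing X X₁] [ExactPairing Y₁ Y₂] [ExactPairing Y Y₁]
    [ExactPairing V₁ V₂] [ExactPairing V V₁] (f : X ⟶ Y) :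
    V₂ ◁ rightMate₂ X₂ X₁ Y₂ Y₁ f =
      rightMate₂ (V₂ ⊗ X₂) (X₁ ⊗ V₁) (V₂ ⊗ Y₂) (Y₁ ⊗ V₁) (V ◁ f) := by
  rw [← MonoidalCategory.id_tensorHom, ← MonoidalCategory.id_tensorHom, rightMate₂_tensor,
    rightMate₂_id]

/-- The canonical isomorphism between two double left duals of `X`. -/
@[simps]
def leftMate₂Iso (X₂ X₁ X₂' X₁' X : C) [ExactPairing X₂ X₁] [ExactPairing X₁ X]
    [ExactPairing X₂' X₁'] [ExactPairing X₁' X] : X₂ ≅ X₂' where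
  hom := leftMate₂ X₂ X₁ X₂' X₁' (𝟙 X)
  inv := leftMate₂ X₂' X₁' X₂ X₁ (𝟙 X)
  hom_inv_id := by rw [leftMate₂_comp, Category.comp_id, leftMate₂_id]
  inv_hom_id := by rw [leftMate₂_comp, Category.comp_id, leftMate₂_id]

/-- The canonical isomorphism between two double right duals of `X`. -/
@[simps]
def rightMate₂Iso (X₂ X₁ X₂' X₁' X : C) [ExactPairing X₁ X₂] [ExactPairing X X₁]
    [ExactPairing X₁' X₂'] [ExactPairing X X₁'] : X₂ ≅ X₂' where
  hom := rightMate₂ X₂ X₁ X₂' X₁' (𝟙 X)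
  inv := rightMate₂ X₂' X₁' X₂ X₁ (𝟙 X)
  hom_inv_id := by rw [rightMate₂_comp, Category.comp_id, rightMate₂_id]
  inv_hom_id := by rw [rightMate₂_comp, Category.comp_id, rightMate₂_id]

variable (C)

theorem leftDoubleDual_obj [LeftRigidCategory C] (X : C) :
    (leftDoubleDual C).obj X = leftDualObj (leftDualObj X) := rfl

theorem leftDoubleDual_map [LeftRigidCategory C] {X Y : C} (f : X ⟶ Y) :
    (leftDoubleDual C).map f =
      leftMate₂ (leftDualObj (leftDualObj X)) (leftDualObj X)
        (leftDualObj (leftDualObj Y)) (leftDualObj Y) f := rfl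

theorem rightDoubleDual_obj [RightRigidCategory C] (X : C) :
    (rightDoubleDual C).obj X = rightDualObj (rightDualObj X) := rfl

theorem rightDoubleDual_map [RightRigidCategory C] {X Y : C} (f : X ⟶ Y) :
    (rightDoubleDual C).map f =
      rightMate₂ (rightDualObj (rightDualObj X)) (rightDualObj X)
        (rightDualObj (rightDualObj Y)) (rightDualObj Y) f := rfl

/-- The canonical monoidal structure of the double left dual functor: its constraints
`𝟙_ ≅ ᘁᘁ𝟙_` and `ᘁᘁX ⊗ ᘁᘁY ≅ ᘁᘁ(X ⊗ Y)` are the canonical isomorphisms between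
double left duals of the same object. -/
def leftDoubleDualCoreMonoidal [LeftRigidCategory C] : (leftDoubleDual C).CoreMonoidal where
  εIso := leftMate₂Iso (𝟙_ C) (𝟙_ C) (leftDualObj (leftDualObj (𝟙_ C))) (leftDualObj (𝟙_ C)) (𝟙_ C)
  μIso X Y := leftMate₂Iso
    (leftDualObj (leftDualObj X) ⊗ leftDualObj (leftDualObj Y)) (leftDualObj Y ⊗ leftDualObj X)
    (leftDualObj (leftDualObj (X ⊗ Y))) (leftDualObj (X ⊗ Y)) (X ⊗ Y)
  μIso_hom_natural_left {X Y} f X' := by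
    simp only [leftDoubleDual_obj, leftDoubleDual_map, leftMate₂Iso_hom]
    rw [leftMate₂_whiskerRight _ _ _ _ (leftDualObj (leftDualObj X')) (leftDualObj X') (V := X'),
      leftMate₂_comp, leftMate₂_comp,
      Category.comp_id, Category.id_comp]
  μIso_hom_natural_right {X Y} X' f := by
    simp only [leftDoubleDual_obj, leftDoubleDual_map, leftMate₂Iso_hom]
    rw [leftMate₂_whiskerLeft _ _ _ _ (leftDualObj (leftDualObj X')) (leftDualObj X') (V := X'),
      leftMate₂_comp, leftMate₂_comp,
      Category.comp_id, Category.id_comp]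
  associativity X Y Z := by
    simp only [leftDoubleDual_obj, leftDoubleDual_map, leftMate₂Iso_hom]
    rw [leftMate₂_whiskerRight _ _ _ _ (leftDualObj (leftDualObj Z)) (leftDualObj Z) (V := Z),
      leftMate₂_whiskerLeft _ _ _ _ (leftDualObj (leftDualObj X)) (leftDualObj X) (V := X),
      ← leftMate₂_associator (leftDualObj (leftDualObj X)) (leftDualObj X)
        (leftDualObj (leftDualObj Y)) (leftDualObj Y) (leftDualObj (leftDualObj Z)) (leftDualObj Z)
        (X := X) (Y := Y) (Z := Z)]
    rw [leftMate₂_comp, leftMate₂_comp, leftMate₂_comp, leftMate₂_comp]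
    simp
  left_unitality X := by
    simp only [leftDoubleDual_obj, leftDoubleDual_map, leftMate₂Iso_hom]
    rw [leftMate₂_whiskerRight _ _ _ _ (leftDualObj (leftDualObj X)) (leftDualObj X) (V := X),
      ← leftMate₂_leftUnitor (leftDualObj (leftDualObj X)) (leftDualObj X) (X := X),
      leftMate₂_comp, leftMate₂_comp]
    simp
  right_unitality X := by
    simp only [leftDoubleDual_obj, leftDoubleDual_map, leftMate₂Iso_hom]
    rw [leftMate₂_whiskerLeft _ _ _ _ (leftDualObj (leftDualObj X)) (leftDualObj X) (V := X),
      ← leftMate₂_rightUnitor (leftDualObj (leftDualObj X)) (leftDualObj X) (X := X),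
      leftMate₂_comp, leftMate₂_comp]
    simp

instance [LeftRigidCategory C] : (leftDoubleDual C).Monoidal :=
  (leftDoubleDualCoreMonoidal C).toMonoidal

/-- The canonical monoidal structure of the double right dual functor: its constraints
`𝟙_ ≅ 𝟙_ᘁᘁ` and `Xᘁᘁ ⊗ Yᘁᘁ ≅ (X ⊗ Y)ᘁᘁ` are the canonical isomorphisms between
double right duals of the same object. -/
def rightDoubleDualCoreMonoidal [RightRigidCategory C] : (rightDoubleDual C).CoreMonoidal where
  εIso := rightMate₂Iso (𝟙_ C) (𝟙_ C) (rightDualObj (rightDualObj (𝟙_ C))) (rightDualObj (𝟙_ C)) (𝟙_ C)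
  μIso X Y := rightMate₂Iso
    (rightDualObj (rightDualObj X) ⊗ rightDualObj (rightDualObj Y)) (rightDualObj Y ⊗ rightDualObj X)
    (rightDualObj (rightDualObj (X ⊗ Y))) (rightDualObj (X ⊗ Y)) (X ⊗ Y)
  μIso_hom_natural_left {X Y} f X' := by
    simp only [rightDoubleDual_obj, rightDoubleDual_map, rightMate₂Iso_hom]
    rw [rightMate₂_whiskerRight _ _ _ _ (rightDualObj (rightDualObj X')) (rightDualObj X') (V := X'),
      rightMate₂_comp, rightMate₂_comp,
      Category.comp_id, Category.id_comp]
  μIso_hom_natural_right {X Y} X' f := by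
    simp only [rightDoubleDual_obj, rightDoubleDual_map, rightMate₂Iso_hom]
    rw [rightMate₂_whiskerLeft _ _ _ _ (rightDualObj (rightDualObj X')) (rightDualObj X') (V := X'),
      rightMate₂_comp, rightMate₂_comp,
      Category.comp_id, Category.id_comp]
  associativity X Y Z := by
    simp only [rightDoubleDual_obj, rightDoubleDual_map, rightMate₂Iso_hom]
    rw [rightMate₂_whiskerRight _ _ _ _ (rightDualObj (rightDualObj Z)) (rightDualObj Z) (V := Z),
      rightMate₂_whiskerLeft _ _ _ _ (rightDualObj (rightDualObj X)) (rightDualObj X) (V := X),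
      ← rightMate₂_associator (rightDualObj (rightDualObj X)) (rightDualObj X)
        (rightDualObj (rightDualObj Y)) (rightDualObj Y) (rightDualObj (rightDualObj Z)) (rightDualObj Z)
        (X := X) (Y := Y) (Z := Z)]
    rw [rightMate₂_comp, rightMate₂_comp, rightMate₂_comp, rightMate₂_comp]
    simp
  left_unitality X := by
    simp only [rightDoubleDual_obj, rightDoubleDual_map, rightMate₂Iso_hom]
    rw [rightMate₂_whiskerRight _ _ _ _ (rightDualObj (rightDualObj X)) (rightDualObj X) (V := X),
      ← rightMate₂_leftUnitor (rightDualObj (rightDualObj X)) (rightDualObj X) (X := X),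
      rightMate₂_comp, rightMate₂_comp]
    simp
  right_unitality X := by
    simp only [rightDoubleDual_obj, rightDoubleDual_map, rightMate₂Iso_hom]
    rw [rightMate₂_whiskerLeft _ _ _ _ (rightDualObj (rightDualObj X)) (rightDualObj X) (V := X),
      ← rightMate₂_rightUnitor (rightDualObj (rightDualObj X)) (rightDualObj X) (X := X),
      rightMate₂_comp, rightMate₂_comp]
    simp

instance [RightRigidCategory C] : (rightDoubleDual C).Monoidal :=
  (rightDoubleDualCoreMonoidal C).toMonoidal

end DoubleDual

/-! ## Bimodule categories -/

section Bimodule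

open scoped MonoidalLeftAction MonoidalRightAction

universe v₁ u₁ v₂ u₂ v₃ u₃ v₄ u₄

variable (A : Type u₁) [Category.{v₁} A] [MonoidalCategory A]
variable (B : Type u₂) [Category.{v₂} B] [MonoidalCategory B]
variable (M : Type u₃) [Category.{v₃} M]
variable (N : Type u₄) [Category.{v₄} N]

/-- Compatibility data of a left action of `A` and a right action of `B` on `M`: a natural middle
associativity isomorphism `(a ⊙ₗ m) ⊙ᵣ b ≅ a ⊙ₗ (m ⊙ᵣ b)` satisfying the two pentagon identities.
With it, `M` is an `A`-`B`-bimodule category (the unit triangles for the middle associativity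
isomorphism follow from these axioms). -/
class MonoidalBiaction [MonoidalLeftAction A M] [MonoidalRightAction B M] where
  /-- The middle associativity isomorphism. -/
  middleIso (a : A) (m : M) (b : B) : (a ⊙ₗ m) ⊙ᵣ b ≅ a ⊙ₗ (m ⊙ᵣ b)
  middleIso_hom_naturality {a a' : A} {m m' : M} {b b' : B} (f : a ⟶ a') (g : m ⟶ m')
    (h : b ⟶ b') :
    ((f ⊙ₗₘ g) ⊙ᵣₘ h) ≫ (middleIso a' m' b').hom = (middleIso a m b).hom ≫ (f ⊙ₗₘ (g ⊙ᵣₘ h))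
  middleIso_tensor_left (a a' : A) (m : M) (b : B) :
    ((αₗ a a' m).hom ⊵ᵣ b) ≫ (middleIso a (a' ⊙ₗ m) b).hom ≫ (a ⊴ₗ (middleIso a' m b).hom) =
      (middleIso (a ⊗ a') m b).hom ≫ (αₗ a a' (m ⊙ᵣ b)).hom
  middleIso_tensor_right (a : A) (m : M) (b b' : B) :
    (middleIso a m (b ⊗ b')).hom ≫ (a ⊴ₗ (αᵣ m b b').hom) =
      (αᵣ (a ⊙ₗ m) b b').hom ≫ ((middleIso a m b).hom ⊵ᵣ b') ≫ (middleIso a (m ⊙ᵣ b) b').hom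

open MonoidalBiaction (middleIso)

variable {M N} in
/-- The structure of a bimodule functor on `F : M ⥤ N`: coherent isomorphisms
`a ⊙ₗ F m ≅ F (a ⊙ₗ m)` and `F m ⊙ᵣ b ≅ F (m ⊙ᵣ b)` making `F` a left module functor and a
right module functor, such that the two ways of passing from `(a ⊙ₗ F m) ⊙ᵣ b` to
`F (a ⊙ₗ (m ⊙ᵣ b))` agree. -/
class BimoduleFunctor (F : M ⥤ N) [MonoidalLeftAction A M] [MonoidalRightAction B M]
    [MonoidalBiaction A B M] [MonoidalLeftAction A N] [MonoidalRightAction B N]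
    [MonoidalBiaction A B N] extends F.LeftLinear A, F.RightLinear B where
  middle_comm (a : A) (m : M) (b : B) :
    (μₗ a m ⊵ᵣ b) ≫ μᵣ (a ⊙ₗ m) b ≫ F.map (middleIso a m b).hom =
      (middleIso a (F.obj m) b).hom ≫ (a ⊴ₗ μᵣ m b) ≫ μₗ a (m ⊙ᵣ b)

end Bimodule

/-! ## Twisting actions -/

section Twist

universe v₁ u₁ v₂ u₂ v₃ u₃

open scoped MonoidalLeftAction MonoidalRightAction
open Functor.LaxMonoidal Functor.OplaxMonoidal Functor.Monoidal
open MonoidalBiaction (middleIso)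

/-- The pullback of a left action along a (strong) monoidal functor `F`: the object `c` acts as
`F c`. -/
abbrev leftActionPullback {C : Type u₁} [Category.{v₁} C] [MonoidalCategory C]
    {C' : Type u₂} [Category.{v₂} C'] [MonoidalCategory C'] (F : C ⥤ C') [F.Monoidal]
    (D : Type u₃) [Category.{v₃} D] [MonoidalLeftAction C' D] : MonoidalLeftAction C D where
  actionObj c d := F.obj c ⊙ₗ d
  actionHomLeft f d := F.map f ⊵ₗ d
  actionHomRight c _ _ g := F.obj c ⊴ₗ g
  actionHom f g := F.map f ⊙ₗₘ g
  actionAssocIso c c' d :=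
    { hom := (δ F c c') ⊵ₗ d ≫ (αₗ (F.obj c) (F.obj c') d).hom
      inv := (αₗ (F.obj c) (F.obj c') d).inv ≫ (μ F c c') ⊵ₗ d
      hom_inv_id := by simp [← MonoidalLeftAction.comp_actionHomLeft]
      inv_hom_id := by simp [← MonoidalLeftAction.comp_actionHomLeft_assoc] }
  actionUnitIso d :=
    { hom := (η F) ⊵ₗ d ≫ (λₗ[C'] d).hom
      inv := (λₗ[C'] d).inv ≫ (ε F) ⊵ₗ d
      hom_inv_id := by simp [← MonoidalLeftAction.comp_actionHomLeft]
      inv_hom_id := by simp [← MonoidalLeftAction.comp_actionHomLeft_assoc] }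
  actionHom_def f g := MonoidalLeftAction.actionHom_def _ _
  actionHomRight_id c d := by simp
  id_actionHomLeft c d := by simp
  actionHom_comp f₁ f₂ g₁ g₂ := by simp
  actionAssocIso_hom_naturality {c₁ c₂ c₃ c₄ d₁ d₂} f g h := by
    dsimp only
    simp only [Category.assoc]
    rw [← MonoidalLeftAction.actionAssocIso_hom_naturality,
      ← MonoidalLeftAction.actionHom_id, ← MonoidalLeftAction.actionHom_id,
      ← MonoidalLeftAction.actionHom_comp_assoc, ← MonoidalLeftAction.actionHom_comp_assoc,
      Functor.OplaxMonoidal.δ_natural, Category.comp_id, Category.id_comp]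
  actionUnitIso_hom_naturality f := by
    dsimp only
    simp only [Category.assoc]
    rw [MonoidalLeftAction.actionUnitIso_hom_naturality,
      MonoidalLeftAction.action_exchange_assoc]
  whiskerLeft_actionHomLeft c c' c'' f d := by
    dsimp only
    rw [Functor.Monoidal.map_whiskerLeft, MonoidalLeftAction.comp_actionHomLeft,
      MonoidalLeftAction.comp_actionHomLeft, MonoidalLeftAction.whiskerLeft_actionHomLeft]
    simp only [Category.assoc]
  whiskerRight_actionHomLeft c f d := by
    dsimp only
    rw [Functor.Monoidal.map_whiskerRight, MonoidalLeftAction.comp_actionHomLeft,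
      MonoidalLeftAction.comp_actionHomLeft, MonoidalLeftAction.whiskerRight_actionHomLeft]
    simp only [Category.assoc]
  associator_actionHom c₁ c₂ c₃ d := by
    have e : (F.obj c₁) ⊴ₗ (δ F c₂ c₃ ⊵ₗ d) = (αₗ _ _ _).inv ≫ (F.obj c₁ ◁ δ F c₂ c₃) ⊵ₗ d ≫
        (αₗ _ _ _).hom := by simp
    have h := congrArg (fun t => t ⊵ₗ d) (Functor.OplaxMonoidal.associativity F c₁ c₂ c₃)
    simp only [MonoidalLeftAction.comp_actionHomLeft] at h
    dsimp only
    simp only [MonoidalLeftAction.actionHomRight_comp, e, Category.assoc,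
      MonoidalLeftAction.actionHomLeft_action, Iso.hom_inv_id_assoc]
    rw [← reassoc_of% h, MonoidalLeftAction.associator_actionHom]
  leftUnitor_actionHom c d := by
    have h := congrArg (fun t => t ⊵ₗ d) (Functor.OplaxMonoidal.left_unitality_hom F c)
    simp only [MonoidalLeftAction.comp_actionHomLeft] at h
    dsimp only
    rw [← h]
    simp only [Category.assoc, MonoidalLeftAction.actionHomLeft_action, Iso.hom_inv_id_assoc,
      MonoidalLeftAction.leftUnitor_actionHom]
  rightUnitor_actionHom c d := by
    have e : (F.obj c) ⊴ₗ (η F ⊵ₗ d) = (αₗ _ _ _).inv ≫ (F.obj c ◁ η F) ⊵ₗ d ≫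
        (αₗ _ _ _).hom := by simp
    have h := congrArg (fun t => t ⊵ₗ d) (Functor.OplaxMonoidal.right_unitality_hom F c)
    simp only [MonoidalLeftAction.comp_actionHomLeft] at h
    dsimp only
    rw [← h]
    simp only [MonoidalLeftAction.actionHomRight_comp, e, Category.assoc, Iso.hom_inv_id_assoc,
      MonoidalLeftAction.rightUnitor_actionHom]

/-- The pullback of a right action along a (strong) monoidal functor `F`: the object `c` acts as
`F c`. -/
abbrev rightActionPullback {C : Type u₁} [Category.{v₁} C] [MonoidalCategory C]
    {C' : Type u₂} [Category.{v₂} C'] [MonoidalCategory C'] (F : C ⥤ C') [F.Monoidal]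
    (D : Type u₃) [Category.{v₃} D] [MonoidalRightAction C' D] : MonoidalRightAction C D where
  actionObj d c := d ⊙ᵣ F.obj c
  actionHomRight d _ _ f := d ⊴ᵣ F.map f
  actionHomLeft g c := g ⊵ᵣ F.obj c
  actionHom g f := g ⊙ᵣₘ F.map f
  actionAssocIso d c c' :=
    { hom := d ⊴ᵣ (δ F c c') ≫ (αᵣ d (F.obj c) (F.obj c')).hom
      inv := (αᵣ d (F.obj c) (F.obj c')).inv ≫ d ⊴ᵣ (μ F c c')
      hom_inv_id := by simp [← MonoidalRightAction.actionHomRight_comp]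
      inv_hom_id := by simp [← MonoidalRightAction.actionHomRight_comp_assoc] }
  actionUnitIso d :=
    { hom := d ⊴ᵣ (η F) ≫ (ρᵣ[C'] d).hom
      inv := (ρᵣ[C'] d).inv ≫ d ⊴ᵣ (ε F)
      hom_inv_id := by simp [← MonoidalRightAction.actionHomRight_comp]
      inv_hom_id := by simp [← MonoidalRightAction.actionHomRight_comp_assoc] }
  actionHom_def f g := MonoidalRightAction.actionHom_def _ _
  actionHomRight_id c d := by simp
  id_actionHomLeft c d := by simp
  actionHom_comp f₁ f₂ g₁ g₂ := by simp
  actionAssocIso_hom_naturality f g h := by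
    dsimp only
    simp only [Category.assoc]
    rw [← MonoidalRightAction.actionAssocIso_hom_naturality,
      ← MonoidalRightAction.id_actionHom, ← MonoidalRightAction.id_actionHom,
      ← MonoidalRightAction.actionHom_comp_assoc, ← MonoidalRightAction.actionHom_comp_assoc,
      Functor.OplaxMonoidal.δ_natural, Category.comp_id, Category.id_comp]
  actionUnitIso_hom_naturality f := by
    dsimp only
    simp only [Category.assoc]
    rw [MonoidalRightAction.actionUnitIso_hom_naturality,
      ← MonoidalRightAction.action_exchange_assoc]
  actionHomRight_whiskerRight f c d := by
    dsimp only
    rw [Functor.Monoidal.map_whiskerRight, MonoidalRightAction.actionHomRight_comp,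
      MonoidalRightAction.actionHomRight_comp, MonoidalRightAction.actionHomRight_whiskerRight]
    simp only [Category.assoc]
  whiskerRight_actionHomLeft c c' c'' f d := by
    dsimp only
    rw [Functor.Monoidal.map_whiskerLeft, MonoidalRightAction.actionHomRight_comp,
      MonoidalRightAction.actionHomRight_comp, MonoidalRightAction.whiskerRight_actionHomLeft]
    simp only [Category.assoc]
  actionHom_associator c₁ c₂ c₃ d := by
    have e : (d ⊴ᵣ δ F c₁ c₂) ⊵ᵣ (F.obj c₃) = (αᵣ _ _ _).inv ≫ d ⊴ᵣ (δ F c₁ c₂ ▷ F.obj c₃) ≫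
        (αᵣ _ _ _).hom := by simp
    have h := congrArg (fun t => d ⊴ᵣ t) (Functor.OplaxMonoidal.associativity F c₁ c₂ c₃)
    simp only [MonoidalRightAction.actionHomRight_comp] at h
    dsimp only
    simp only [MonoidalRightAction.comp_actionHomLeft, e, Category.assoc,
      MonoidalRightAction.action_actionHomRight, Iso.hom_inv_id_assoc]
    rw [← reassoc_of% h, MonoidalRightAction.actionHom_associator]
  actionHom_leftUnitor c d := by
    have e : (d ⊴ᵣ η F) ⊵ᵣ (F.obj c) = (αᵣ _ _ _).inv ≫ d ⊴ᵣ (η F ▷ F.obj c) ≫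
        (αᵣ _ _ _).hom := by simp
    have h := congrArg (fun t => d ⊴ᵣ t) (Functor.OplaxMonoidal.left_unitality_hom F c)
    simp only [MonoidalRightAction.actionHomRight_comp] at h
    dsimp only
    rw [← h]
    simp only [MonoidalRightAction.comp_actionHomLeft, e, Category.assoc, Iso.hom_inv_id_assoc,
      MonoidalRightAction.actionHom_leftUnitor]
  actionHom_rightUnitor c d := by
    have h := congrArg (fun t => d ⊴ᵣ t) (Functor.OplaxMonoidal.right_unitality_hom F c)
    simp only [MonoidalRightAction.actionHomRight_comp] at h
    dsimp only
    rw [← h]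
    simp only [Category.assoc, MonoidalRightAction.action_actionHomRight, Iso.hom_inv_id_assoc,
      MonoidalRightAction.actionHom_rightUnitor]

/-- The pullback of the middle associativity isomorphism along monoidal functors. -/
abbrev biactionPullback {A A' : Type u₁} [Category.{v₁} A] [MonoidalCategory A] [Category.{v₁} A']
    [MonoidalCategory A'] {B B' : Type u₂} [Category.{v₂} B] [MonoidalCategory B] [Category.{v₂} B']
    [MonoidalCategory B'] (F : A ⥤ A') [F.Monoidal] (G : B ⥤ B') [G.Monoidal] (M : Type u₃)
    [Category.{v₃} M] [MonoidalLeftAction A' M] [MonoidalRightAction B' M]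
    [MonoidalBiaction A' B' M] :
    @MonoidalBiaction A _ _ B _ _ M _ (leftActionPullback F M) (rightActionPullback G M) :=
  letI := leftActionPullback F M
  letI := rightActionPullback G M
  { middleIso a m b := (middleIso (F.obj a) m (G.obj b) : (F.obj a ⊙ₗ m) ⊙ᵣ G.obj b ≅ _)
    middleIso_hom_naturality f g h :=
      MonoidalBiaction.middleIso_hom_naturality (F.map f) g (G.map h)
    middleIso_tensor_left a a' m b := by
      change ((δ F a a' ⊵ₗ m ≫ (αₗ (F.obj a) (F.obj a') m).hom) ⊵ᵣ G.obj b) ≫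
          (middleIso (F.obj a) (F.obj a' ⊙ₗ m) (G.obj b)).hom ≫
            (F.obj a ⊴ₗ (middleIso (F.obj a') m (G.obj b)).hom) =
        (middleIso (F.obj (a ⊗ a')) m (G.obj b)).hom ≫
          δ F a a' ⊵ₗ (m ⊙ᵣ G.obj b) ≫ (αₗ (F.obj a) (F.obj a') (m ⊙ᵣ G.obj b)).hom
      have h := MonoidalBiaction.middleIso_hom_naturality (δ F a a') (𝟙 m) (𝟙 (G.obj b))
      simp only [MonoidalLeftAction.actionHom_id, MonoidalRightAction.actionHom_id,
        MonoidalRightAction.id_actionHomLeft] at h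
      rw [MonoidalRightAction.comp_actionHomLeft, Category.assoc,
        MonoidalBiaction.middleIso_tensor_left, reassoc_of% h]
    middleIso_tensor_right a m b b' := by
      change (middleIso (F.obj a) m (G.obj (b ⊗ b'))).hom ≫
          (F.obj a ⊴ₗ (m ⊴ᵣ δ G b b' ≫ (αᵣ m (G.obj b) (G.obj b')).hom)) =
        ((F.obj a ⊙ₗ m) ⊴ᵣ δ G b b' ≫ (αᵣ (F.obj a ⊙ₗ m) (G.obj b) (G.obj b')).hom) ≫
          ((middleIso (F.obj a) m (G.obj b)).hom ⊵ᵣ G.obj b') ≫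
            (middleIso (F.obj a) (m ⊙ᵣ G.obj b) (G.obj b')).hom
      have h := MonoidalBiaction.middleIso_hom_naturality (𝟙 (F.obj a)) (𝟙 m) (δ G b b')
      simp only [MonoidalLeftAction.id_actionHom, MonoidalRightAction.id_actionHom,
        MonoidalLeftAction.actionHomRight_id] at h
      rw [MonoidalLeftAction.actionHomRight_comp, ← reassoc_of% h,
        MonoidalBiaction.middleIso_tensor_right, Category.assoc] }

/-- The bimodule category `^{∨∨}M^{∨∨}`: the category `M`, on which `a` acts from the left as the
double left dual `ᘁᘁa`, and `b` acts from the right as the double right dual `bᘁᘁ`. -/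
def DoubleDualTwist (M : Type u₃) : Type u₃ := M

variable (A : Type u₁) [Category.{v₁} A] [MonoidalCategory A]
variable (B : Type u₂) [Category.{v₂} B] [MonoidalCategory B]
variable (M : Type u₃) [Category.{v₃} M]

instance : Category.{v₃} (DoubleDualTwist M) := inferInstanceAs (Category.{v₃} M)

/-- The identity functor, seen as a functor from `M` to its twisted version. -/
def toDoubleDualTwist : M ⥤ DoubleDualTwist M := 𝟭 M

instance [LeftRigidCategory A] [MonoidalLeftAction A M] :
    MonoidalLeftAction A (DoubleDualTwist M) :=
  leftActionPullback (leftDoubleDual A) M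

instance [RightRigidCategory B] [MonoidalRightAction B M] :
    MonoidalRightAction B (DoubleDualTwist M) :=
  rightActionPullback (rightDoubleDual B) M

instance [LeftRigidCategory A] [RightRigidCategory B] [MonoidalLeftAction A M]
    [MonoidalRightAction B M] [MonoidalBiaction A B M] : MonoidalBiaction A B (DoubleDualTwist M) :=
  biactionPullback (leftDoubleDual A) (rightDoubleDual B) M

end Twist

/-! ## Finite tensor categories and finite bimodule categories -/

section Finite

universe w v₁ u₁ v₂ u₂ v₃ u₃

/-- A rigid monoidal `k`-linear category is a *finite tensor category* if it is finite as a linear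
category, its tensor product is bilinear, and its monoidal unit has only scalar endomorphisms. -/
class IsFiniteTensorCategory (k : Type w) [Field k] (A : Type u₁) [Category.{v₁} A]
    [Preadditive A] [Linear k A] [MonoidalCategory A] [RigidCategory A] : Prop extends
    IsFiniteLinear k A, MonoidalPreadditive A, MonoidalLinear k A where
  finrank_end_unit : Module.finrank k (𝟙_ A ⟶ 𝟙_ A) = 1

/-- The linearity and exactness conditions for an `A`-`B`-bimodule category `M`: both actions are
bilinear, and exact in the variable of the tensor category. -/
class IsBilinearExactBiaction (k : Type w) [Field k]
    (A : Type u₁) [Category.{v₁} A] [Preadditive A] [Linear k A] [MonoidalCategory A]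
    (B : Type u₂) [Category.{v₂} B] [Preadditive B] [Linear k B] [MonoidalCategory B]
    (M : Type u₃) [Category.{v₃} M] [Preadditive M] [Linear k M]
    [MonoidalLeftAction A M] [MonoidalRightAction B M] : Prop where
  left_additive (a : A) : (MonoidalLeftAction.actionLeft M a).Additive
  left_linear (a : A) : (MonoidalLeftAction.actionLeft M a).Linear k
  left_additive_of_obj (m : M) : (MonoidalLeftAction.actionRight (C := A) m).Additive
  left_linear_of_obj (m : M) : (MonoidalLeftAction.actionRight (C := A) m).Linear k
  left_preservesFiniteLimits (m : M) :
    PreservesFiniteLimits (MonoidalLeftAction.actionRight (C := A) m)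
  left_preservesFiniteColimits (m : M) :
    PreservesFiniteColimits (MonoidalLeftAction.actionRight (C := A) m)
  right_additive (b : B) : (MonoidalRightAction.actionRight M b).Additive
  right_linear (b : B) : (MonoidalRightAction.actionRight M b).Linear k
  right_additive_of_obj (m : M) : (MonoidalRightAction.actionLeft (C := B) m).Additive
  right_linear_of_obj (m : M) : (MonoidalRightAction.actionLeft (C := B) m).Linear k
  right_preservesFiniteLimits (m : M) :
    PreservesFiniteLimits (MonoidalRightAction.actionLeft (C := B) m)
  right_preservesFiniteColimits (m : M) :
    PreservesFiniteColimits (MonoidalRightAction.actionLeft (C := B) m)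

end Finite

universe w v₁ u₁ v₂ u₂ v₃ u₃

/-!
The Nakayama functor `N` is described by its universal family: linear maps
`ι_x : Hom(y, x)^* → Hom(x, N y)`, dinatural in `x` (`DualHomFamily`, `nakayamaι`), through which
every other such family factors uniquely.

*Existence and exactness.* A finite linear category has an object `p` (the regular module) for which
`Hom(p, -)` is fully faithful as a functor to `End(p)`-modules. A dinatural family is determined by
its component at `p`, which only has to be compatible with `End(p)`, so the coend is a coequalizer
of two maps `(Hom(y, p)^* ⊗ End(p)) ⊗ p ⇉ Hom(y, p)^* ⊗ p` (`hasCoend_nakayamaIntegrand`). Since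
`y ↦ Hom(y, x)^*` is linear and right exact, so is `N` (`nakayama_preservesCokernel`).

*Commuting with adjoints.* For linear adjunctions `G ⊣ H ⊣ K` there is a canonical morphism
`N (G y) ⟶ K (N y)` (`nakayamaIntertwinerApp`): a functional on `Hom(G y, x) ≅ Hom(y, H x)` gives a
morphism `H x ⟶ N y`, hence a morphism `x ⟶ K (N y)`. It is natural in `y`, compatible with
conjugate transformations and with composition of adjunctions, and it is invertible as soon as `K`
has a right adjoint too, for then `K` preserves the coend.

*Bimodule structure.* Acting by `a` is left adjoint to acting by its left dual, which in turn is
left adjoint to acting by the double left dual (`MonoidalLeftAction.dualAdjunction`), and in the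
same way for right actions and right duals. This gives `N (a ⊙ m) ≅ ᘁᘁa ⊙ N m` and `N (m ⊙ b) ≅ N m ⊙ bᘁᘁ`.
All coherence conditions are instances of `nakayamaIntertwinerApp_conjugate` and
`nakayamaIntertwinerApp_comp`, once it is known that the constraints of the actions are conjugate to
the constraints for the dual objects: `conjugateEquiv_dualAdjunction_map`,
`conjugateEquiv_dualAdjunction_tensor`, `conjugateEquiv_dualAdjunction_unit` and, for the
associativity `(a ⊙ m) ⊙ b ≅ a ⊙ (m ⊙ b)`, `MonoidalBiaction.conjugateEquiv_middleNatIso`.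
-/

/-! ### Existence of the coend -/

section Existence

universe v u

variable (k : Type w) [Field k] {X : Type u} [Category.{v} X] [Preadditive X] [Linear k X]

/-- An object `p` is *dense* if every map `Hom(p, x) → Hom(p, z)` that is additive and compatible
with precomposition by endomorphisms of `p` is given by a unique morphism `x ⟶ z`: the functor
`Hom(p, -)` into the right `End(p)`-modules is fully faithful. -/
def IsDenseObject (p : X) : Prop :=
  ∀ ⦃x z : X⦄ (θ : (p ⟶ x) → (p ⟶ z)), (∀ h h', θ (h + h') = θ h + θ h') →
    (∀ (g : p ⟶ p) h, θ (g ≫ h) = g ≫ θ h) → ∃! f : x ⟶ z, ∀ h, h ≫ f = θ h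

theorem IsDenseObject.hom_ext {p : X} (hp : IsDenseObject p) {x z : X} {f f' : x ⟶ z}
    (h : ∀ g : p ⟶ x, g ≫ f = g ≫ f') : f = f' :=
  (hp (fun g => g ≫ f) (by simp) (by simp)).unique (fun _ => rfl) (fun g => (h g).symm)

/-- In the category of finitely generated `R`-modules, the regular module is dense. -/
theorem IsFiniteLinear.exists_isDenseObject [IsFiniteLinear k X] : ∃ p : X, IsDenseObject p := by
  obtain ⟨R, _, _, _, e, _, _⟩ := IsFiniteLinear.exists_equivalence (k := k) (X := X)
  let S := e.functor
  let u : S.obj (e.inverse.obj (FGModuleCat.of R R)) ≅ FGModuleCat.of R R := e.counitIso.app _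
  -- the morphism `p ⟶ x` that corresponds to an element of `S x`
  let t (x : X) (v : S.obj x) : e.inverse.obj (FGModuleCat.of R R) ⟶ x :=
    S.preimage (u.hom ≫ FGModuleCat.ofHom (LinearMap.toSpanSingleton R (S.obj x) v))
  have St (x : X) (v : S.obj x) : S.map (t x v) =
      u.hom ≫ FGModuleCat.ofHom (LinearMap.toSpanSingleton R (S.obj x) v) := S.map_preimage _
  have t_surj (x : X) (g : e.inverse.obj (FGModuleCat.of R R) ⟶ x) :
      ∃ v, t x v = g := by
    refine ⟨(u.inv ≫ S.map g).hom.hom (1 : R), S.map_injective ?_⟩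
    rw [St, ← Iso.eq_inv_comp]
    apply FGModuleCat.hom_ext
    apply LinearMap.ext_ring
    exact one_smul R ((u.inv ≫ S.map g).hom.hom (1 : R))
  have t_comp {x z : X} (v : S.obj x) (f : x ⟶ z) : t x v ≫ f = t z ((S.map f).hom.hom v) := by
    apply S.map_injective
    rw [S.map_comp, St, St, Category.assoc]
    congr 1
    apply FGModuleCat.hom_ext
    apply LinearMap.ext_ring
    change (S.map f).hom.hom ((1 : R) • v) = (1 : R) • _
    rw [one_smul, one_smul]
  have t_eq {x : X} {v v' : S.obj x} (h : t x v = t x v') : v = v' := by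
    have h' := congrArg S.map h
    rw [St, St, cancel_epi] at h'
    have := LinearMap.congr_fun (congrArg (fun q => q.hom.hom) h') (1 : R)
    change (1 : R) • v = (1 : R) • v' at this
    rwa [one_smul, one_smul] at this
  have t_add {x : X} (v v' : S.obj x) : t x (v + v') = t x v + t x v' := by
    apply S.map_injective
    rw [S.map_add, St, St, St, ← Preadditive.comp_add]
    congr 1
    apply FGModuleCat.hom_ext
    apply LinearMap.ext_ring
    change (1 : R) • (v + v') = (1 : R) • v + (1 : R) • v'
    rw [smul_add]
  have t_smul (r : R) : ∃ g : e.inverse.obj (FGModuleCat.of R R) ⟶ _, ∀ (x : X) (v : S.obj x),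
      t x (r • v) = g ≫ t x v := by
    refine ⟨S.preimage (u.hom ≫ FGModuleCat.ofHom (LinearMap.toSpanSingleton R R r) ≫ u.inv),
      fun x v => S.map_injective ?_⟩
    rw [S.map_comp, St, St, S.map_preimage]
    simp only [Category.assoc, Iso.inv_hom_id_assoc]
    congr 1
    apply FGModuleCat.hom_ext
    apply LinearMap.ext_ring
    change (1 : R) • (r • v) = ((1 : R) • r) • v
    rw [one_smul, one_smul]
  refine ⟨e.inverse.obj (FGModuleCat.of R R), fun x z θ hadd hcomp => ?_⟩
  choose s hs using t_surj z
  let φ : S.obj x →ₗ[R] S.obj z :=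
    { toFun v := s (θ (t x v))
      map_add' v v' := t_eq (by rw [hs, t_add, t_add, hs, hs, hadd])
      map_smul' r v := t_eq (by
        obtain ⟨g, hg⟩ := t_smul r
        rw [RingHom.id_apply, hs, hg, hg, hs, hcomp]) }
  refine ⟨S.preimage (FGModuleCat.ofHom φ), fun h => ?_, fun f hf => ?_⟩
  · obtain ⟨v, rfl⟩ := t_surj x h
    rw [t_comp, S.map_preimage]
    exact hs _
  · apply S.map_injective
    rw [S.map_preimage]
    apply FGModuleCat.hom_ext
    ext v
    apply t_eq
    rw [← t_comp, hf]
    exact (hs _).symm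

theorem IsFiniteLinear.hasFiniteColimits [IsFiniteLinear k X] : HasFiniteColimits X := by
  obtain ⟨R, _, _, _, e, _, _⟩ := IsFiniteLinear.exists_equivalence (k := k) (X := X)
  have : IsNoetherianRing R := IsNoetherianRing.of_finite k R
  exact ⟨fun J _ _ => Adjunction.hasColimitsOfShape_of_equivalence e.functor⟩

theorem comp_rightComp_add {y x x' : X} (ξ : Module.Dual k (y ⟶ x')) (g g' : x ⟶ x') :
    ξ ∘ₗ Linear.rightComp k y (g + g') =
      ξ ∘ₗ Linear.rightComp k y g + ξ ∘ₗ Linear.rightComp k y g' := by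
  ext h
  simp

theorem comp_rightComp_smul {y x x' : X} (ξ : Module.Dual k (y ⟶ x')) (c : k) (g : x ⟶ x') :
    ξ ∘ₗ Linear.rightComp k y (c • g) = c • (ξ ∘ₗ Linear.rightComp k y g) := by
  ext h
  simp

theorem comp_rightComp_comp {y x x' x'' : X} (ξ : Module.Dual k (y ⟶ x'')) (g : x ⟶ x')
    (g' : x' ⟶ x'') : ξ ∘ₗ Linear.rightComp k y (g ≫ g') =
      (ξ ∘ₗ Linear.rightComp k y g') ∘ₗ Linear.rightComp k y g := by
  ext h
  simp

theorem dualHomMap_id_left {y x x' : X} (g : x ⟶ x') (ξ : Module.Dual k (y ⟶ x')) :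
    dualHomMap k (𝟙 y) g ξ = ξ ∘ₗ Linear.rightComp k y g := by
  ext h
  simp

/-- A dinatural family of linear maps `Hom(y, x)^* → Hom(x, z)`. By the universal property of
`Hom(y, x)^* ⊗ x` this is the same as a cowedge with vertex `z` for the coend that defines the
Nakayama functor. Dinaturality is spelled out as `app_comp`, in which `ξ ∘ₗ rightComp k y g` is the
functional `h ↦ ξ (h ≫ g)`. -/
structure DualHomFamily (y z : X) where
  /-- The component at `x`. -/
  app (x : X) : Module.Dual k (y ⟶ x) →ₗ[k] (x ⟶ z)
  app_comp {x x' : X} (g : x ⟶ x') (ξ : Module.Dual k (y ⟶ x')) :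
    app x (ξ ∘ₗ Linear.rightComp k y g) = g ≫ app x' ξ

variable {k}

/-- A dinatural family may be prescribed at a dense object `p`, subject only to dinaturality with
respect to the endomorphisms of `p`. -/
theorem DualHomFamily.exists_of_isDenseObject {p : X} (hp : IsDenseObject p) {y z : X}
    (φ : Module.Dual k (y ⟶ p) →ₗ[k] (p ⟶ z))
    (hφ : ∀ (g : p ⟶ p) ξ, φ (ξ ∘ₗ Linear.rightComp k y g) = g ≫ φ ξ) :
    ∃ ψ : DualHomFamily k y z, ψ.app p = φ := by
  have H (x : X) (ξ : Module.Dual k (y ⟶ x)) :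
      ∃! f : x ⟶ z, ∀ h : p ⟶ x, h ≫ f = φ (ξ ∘ₗ Linear.rightComp k y h) := by
    refine hp _ (fun h h' => ?_) (fun g h => ?_)
    · rw [comp_rightComp_add, map_add]
    · rw [comp_rightComp_comp, hφ]
  -- dinaturality along all `h : p ⟶ x` forces the value at `ξ` to be the morphism given by `H`
  choose f hf using fun x ξ => (H x ξ).exists
  refine ⟨{ app x :=
              { toFun := f x
                map_add' ξ ξ' := hp.hom_ext fun h => ?_
                map_smul' c ξ := hp.hom_ext fun h => ?_ }
            app_comp {x x'} g ξ := hp.hom_ext fun h => ?_ }, ?_⟩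
  · rw [Preadditive.comp_add, hf, hf, hf, LinearMap.add_comp, map_add]
  · rw [RingHom.id_apply, Linear.comp_smul, hf, hf, LinearMap.smul_comp, map_smul]
  · change h ≫ f x _ = h ≫ g ≫ f x' ξ
    rw [hf, ← Category.assoc, hf, comp_rightComp_comp]
  · ext ξ
    refine hp.hom_ext fun h => ?_
    change h ≫ f p ξ = _
    rw [hf, hφ]

variable [IsFiniteLinear k X]

/-- The cowedge over the integrand of the Nakayama functor that corresponds to a dinatural
family. -/
noncomputable def DualHomFamily.cowedge {y z : X} (φ : DualHomFamily k y z) :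
    Cowedge ((nakayamaIntegrand k X).obj y) :=
  Cowedge.mk z (fun x => (copowerHomEquiv k (Module.Dual k (y ⟶ x)) x z).symm (φ.app x)) (by
    intro x x' g
    apply copower_hom_ext
    intro ξ
    change copowerUnit k _ _ ξ ≫ copowerMap k _ _ ≫ _ = copowerUnit k _ _ ξ ≫ copowerMap k _ _ ≫ _
    rw [copowerUnit_map_assoc, copowerUnit_map_assoc, ← copowerHomEquiv_apply,
      ← copowerHomEquiv_apply, LinearEquiv.apply_symm_apply, LinearEquiv.apply_symm_apply,
      Category.id_comp, LinearMap.id_apply, ← φ.app_comp]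
    exact congrArg (φ.app x) (dualHomMap_id_left k g ξ))

/-- The structure maps of a cowedge over the integrand of the Nakayama functor, with their source
displayed as a copower. -/
noncomputable def nakayamaCowedgeπ {y : X} (c : Cowedge ((nakayamaIntegrand k X).obj y)) (x : X) :
    copower k (Module.Dual k (y ⟶ x)) x ⟶ c.pt :=
  c.π x

theorem nakayamaCowedgeπ_condition {y : X} (c : Cowedge ((nakayamaIntegrand k X).obj y)) {x x' : X}
    (g : x ⟶ x') : copowerMap k (dualHomMap k (𝟙 y) g) (𝟙 x) ≫ nakayamaCowedgeπ c x =
      copowerMap k LinearMap.id g ≫ nakayamaCowedgeπ c x' :=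
  c.condition g

/-- The dinatural family that corresponds to a cowedge. -/
noncomputable def DualHomFamily.ofCowedge {y : X} (c : Cowedge ((nakayamaIntegrand k X).obj y)) :
    DualHomFamily k y c.pt where
  app x := copowerHomEquiv k (Module.Dual k (y ⟶ x)) x c.pt (nakayamaCowedgeπ c x)
  app_comp {x x'} g ξ := by
    have h := congrArg (fun t => copowerUnit k (Module.Dual k (y ⟶ x')) x ξ ≫ t)
      (nakayamaCowedgeπ_condition c g)
    rw [copowerUnit_map_assoc, copowerUnit_map_assoc, dualHomMap_id_left] at h
    rw [copowerHomEquiv_apply, copowerHomEquiv_apply]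
    simpa using h

theorem DualHomFamily.ofCowedge_cowedge_app {y z : X} (φ : DualHomFamily k y z) (x : X) :
    (DualHomFamily.ofCowedge φ.cowedge).app x = φ.app x :=
  LinearEquiv.apply_symm_apply _ _

theorem DualHomFamily.ofCowedge_app_comp {y z : X} (c : Cowedge ((nakayamaIntegrand k X).obj y))
    (f : c.pt ⟶ z) (x : X) (ξ : Module.Dual k (y ⟶ x)) :
    copowerUnit k (Module.Dual k (y ⟶ x)) x ξ ≫ nakayamaCowedgeπ c x ≫ f =
      (DualHomFamily.ofCowedge c).app x ξ ≫ f := by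
  rw [← Category.assoc, ← copowerHomEquiv_apply]
  rfl

/-- A universal dinatural family yields a coend. -/
theorem DualHomFamily.hasCoend {y c : X} (ι : DualHomFamily k y c)
    (h : ∀ (z : X) (φ : DualHomFamily k y z), ∃! f : c ⟶ z, ∀ x ξ, ι.app x ξ ≫ f = φ.app x ξ) :
    HasCoend ((nakayamaIntegrand k X).obj y) := by
  have iff (s : Cowedge ((nakayamaIntegrand k X).obj y)) (f : ι.cowedge.pt ⟶ s.pt) (x : X) :
      nakayamaCowedgeπ ι.cowedge x ≫ f = nakayamaCowedgeπ s x ↔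
      ∀ ξ, ι.app x ξ ≫ f = (DualHomFamily.ofCowedge s).app x ξ := by
    have e (ξ : Module.Dual k (y ⟶ x)) : ι.app x ξ ≫ f =
        copowerHomEquiv k (Module.Dual k (y ⟶ x)) x s.pt (nakayamaCowedgeπ ι.cowedge x ≫ f) ξ := by
      rw [copowerHomEquiv_apply, ofCowedge_app_comp, ofCowedge_cowedge_app]
      rfl
    simp only [e]
    constructor
    · intro h' ξ
      rw [h']
      rfl
    · intro h'
      exact (copowerHomEquiv k _ _ _).injective (LinearMap.ext h')
  exact ⟨⟨ι.cowedge, Multicofork.IsColimit.mk _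
    (fun s => (h _ (DualHomFamily.ofCowedge s)).choose)
    (fun s x => (iff s _ x).2 ((h _ (DualHomFamily.ofCowedge s)).choose_spec.1 x))
    (fun s f hf => (h _ (DualHomFamily.ofCowedge s)).choose_spec.2 f
      fun x => (iff s f x).1 (hf x))⟩⟩

variable (k)

/-- With `p` a dense object and `V = Hom(y, p)^*`, the coend is the quotient of `V ⊗ p` by the
relations coming from the endomorphisms of `p` alone, which is a finite colimit. -/
theorem hasCoend_nakayamaIntegrand (y : X) : HasCoend ((nakayamaIntegrand k X).obj y) := by
  obtain ⟨p, hp⟩ := IsFiniteLinear.exists_isDenseObject k (X := X)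
  have := IsFiniteLinear.hasFiniteColimits k (X := X)
  let V := Module.Dual k (y ⟶ p)
  let f₁ : copower k (TensorProduct k V (p ⟶ p)) p ⟶ copower k V p :=
    (copowerHomEquiv k _ _ _).symm (TensorProduct.lift (LinearMap.mk₂ k
      (fun ξ g => copowerUnit k V p (ξ ∘ₗ Linear.rightComp k y g))
      (fun ξ ξ' g => by rw [LinearMap.add_comp, map_add])
      (fun c ξ g => by rw [LinearMap.smul_comp, map_smul])
      (fun ξ g g' => by rw [comp_rightComp_add, map_add])
      (fun c ξ g => by rw [comp_rightComp_smul, map_smul])))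
  let f₂ : copower k (TensorProduct k V (p ⟶ p)) p ⟶ copower k V p :=
    (copowerHomEquiv k _ _ _).symm (TensorProduct.lift (LinearMap.mk₂ k
      (fun ξ g => g ≫ copowerUnit k V p ξ)
      (fun ξ ξ' g => by simp) (fun c ξ g => by simp) (fun ξ g g' => by simp)
      (fun c ξ g => by simp)))
  have h₁ (ξ : V) (g : p ⟶ p) : copowerUnit k _ p (ξ ⊗ₜ[k] g) ≫ f₁ =
      copowerUnit k V p (ξ ∘ₗ Linear.rightComp k y g) := by
    rw [← copowerHomEquiv_apply, LinearEquiv.apply_symm_apply]; rfl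
  have h₂ (ξ : V) (g : p ⟶ p) : copowerUnit k _ p (ξ ⊗ₜ[k] g) ≫ f₂ =
      g ≫ copowerUnit k V p ξ := by
    rw [← copowerHomEquiv_apply, LinearEquiv.apply_symm_apply]; rfl
  obtain ⟨ι, hι⟩ := DualHomFamily.exists_of_isDenseObject hp
    (copowerHomEquiv k V p _ (coequalizer.π f₁ f₂)) (fun g ξ => by
      rw [copowerHomEquiv_apply, copowerHomEquiv_apply, ← h₁, Category.assoc,
        coequalizer.condition, ← Category.assoc, h₂, Category.assoc])
  have hι' (ξ : V) : ι.app p ξ = copowerUnit k V p ξ ≫ coequalizer.π f₁ f₂ := by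
    rw [hι, copowerHomEquiv_apply]
  refine ι.hasCoend fun z φ => ?_
  have hφ (ξ : V) : copowerUnit k V p ξ ≫ (copowerHomEquiv k V p z).symm (φ.app p) =
      φ.app p ξ := by
    rw [← copowerHomEquiv_apply, LinearEquiv.apply_symm_apply]
  refine ⟨coequalizer.desc ((copowerHomEquiv k V p z).symm (φ.app p)) ?_, ?_, ?_⟩
  · apply (copowerHomEquiv k _ _ _).injective
    apply TensorProduct.ext'
    intro ξ g
    rw [copowerHomEquiv_apply, copowerHomEquiv_apply, ← Category.assoc, ← Category.assoc, h₁, h₂,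
      hφ, Category.assoc, hφ, φ.app_comp]
  · intro x ξ
    refine hp.hom_ext fun h => ?_
    rw [← Category.assoc, ← ι.app_comp, ← φ.app_comp, hι', Category.assoc, coequalizer.π_desc, hφ]
  · intro f hf
    apply coequalizer.hom_ext
    apply copower_hom_ext
    intro ξ
    rw [coequalizer.π_desc, hφ, ← Category.assoc, ← hι', hf]

end Existence

/-! ### The universal family, linearity and right exactness -/

section NakayamaFunctor

universe v u

variable (k : Type w) [Field k] {X : Type u} [Category.{v} X] [Preadditive X] [Linear k X]
  [IsFiniteLinear k X] [∀ y : X, HasCoend ((nakayamaIntegrand k X).obj y)]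

/-- The universal dinatural family: the structure maps of the coend `N y`, seen as linear maps
`Hom(y, x)^* → Hom(x, N y)`. -/
noncomputable def nakayamaι (y : X) : DualHomFamily k y ((nakayamaFunctor k X).obj y) :=
  DualHomFamily.ofCowedge (Multicoequalizer.multicofork _)

variable {k}

variable (k) in
/-- The structure map `Hom(y, x)^* ⊗ x ⟶ N y` of the coend, with its source and target displayed. -/
noncomputable def nakayamaCoendι (y x : X) :
    copower k (Module.Dual k (y ⟶ x)) x ⟶ (nakayamaFunctor k X).obj y :=
  coend.ι ((nakayamaIntegrand k X).obj y) x

theorem nakayamaι_comp_eq {y z : X} (f : (nakayamaFunctor k X).obj y ⟶ z) (x : X)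
    (ξ : Module.Dual k (y ⟶ x)) : (nakayamaι k y).app x ξ ≫ f =
      copowerUnit k (Module.Dual k (y ⟶ x)) x ξ ≫ nakayamaCoendι k y x ≫ f :=
  (DualHomFamily.ofCowedge_app_comp _ _ _ _).symm

theorem copowerUnit_nakayamaCoendι (y x : X) (ξ : Module.Dual k (y ⟶ x)) :
    copowerUnit k (Module.Dual k (y ⟶ x)) x ξ ≫ nakayamaCoendι k y x = (nakayamaι k y).app x ξ :=
  (copowerHomEquiv_apply k _ _ _).symm

theorem comp_nakayamaι {y x x' : X} (g : x ⟶ x') (ξ : Module.Dual k (y ⟶ x')) :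
    g ≫ (nakayamaι k y).app x' ξ = (nakayamaι k y).app x (ξ ∘ₗ Linear.rightComp k y g) :=
  ((nakayamaι k y).app_comp g ξ).symm

theorem nakayama_hom_ext {y z : X} {f f' : (nakayamaFunctor k X).obj y ⟶ z}
    (h : ∀ x ξ, (nakayamaι k y).app x ξ ≫ f = (nakayamaι k y).app x ξ ≫ f') : f = f' := by
  refine coend.hom_ext fun x => copower_hom_ext k fun ξ => ?_
  have := h x ξ
  rw [nakayamaι_comp_eq, nakayamaι_comp_eq] at this
  exact this

/-- The morphism `N y ⟶ z` determined by a dinatural family. -/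
noncomputable def nakayamaDesc {y z : X} (φ : DualHomFamily k y z) :
    (nakayamaFunctor k X).obj y ⟶ z :=
  coend.desc (F := (nakayamaIntegrand k X).obj y)
    (fun x => nakayamaCowedgeπ φ.cowedge x) (fun _ _ g => nakayamaCowedgeπ_condition φ.cowedge g)

@[simp]
theorem nakayamaι_desc {y z : X} (φ : DualHomFamily k y z) (x : X) (ξ : Module.Dual k (y ⟶ x)) :
    (nakayamaι k y).app x ξ ≫ nakayamaDesc φ = φ.app x ξ := by
  have h : nakayamaCoendι k y x ≫ nakayamaDesc φ =
      nakayamaCowedgeπ φ.cowedge x := coend.ι_desc _ _ x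
  rw [nakayamaι_comp_eq, ← DualHomFamily.ofCowedge_cowedge_app φ x]
  exact (congrArg (fun t => copowerUnit k (Module.Dual k (y ⟶ x)) x ξ ≫ t) h).trans
    (copowerHomEquiv_apply k _ _ _).symm

theorem nakayamaι_map {y y' : X} (f : y ⟶ y') (x : X) (ξ : Module.Dual k (y ⟶ x)) :
    (nakayamaι k y).app x ξ ≫ (nakayamaFunctor k X).map f =
      (nakayamaι k y').app x (ξ ∘ₗ Linear.leftComp k x f) := by
  have h : nakayamaCoendι k y x ≫ (nakayamaFunctor k X).map f =
      copowerMap k (dualHomMap k f (𝟙 x)) (𝟙 x) ≫ nakayamaCoendι k y' x :=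
    coend.ι_map _ x
  have e : dualHomMap k f (𝟙 x) ξ = ξ ∘ₗ Linear.leftComp k x f := by ext h; simp
  rw [nakayamaι_comp_eq, h, copowerUnit_map_assoc, Category.id_comp, copowerUnit_nakayamaCoendι, e]

instance : (nakayamaFunctor k X).Additive where
  map_add {y y' f f'} := nakayama_hom_ext fun x ξ => by
    rw [Preadditive.comp_add, nakayamaι_map, nakayamaι_map, nakayamaι_map, ← map_add]
    congr 1
    ext h
    simp

instance : (nakayamaFunctor k X).Linear k where
  map_smul {y y'} f c := nakayama_hom_ext fun x ξ => by
    rw [Linear.comp_smul, nakayamaι_map, nakayamaι_map, ← map_smul]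
    congr 1
    ext h
    simp

/-- For a cokernel `c` of `f`, the functionals on `Hom(c, x)` are the restrictions of the
functionals on `Hom(y₂, x)`, and two of these have the same restriction iff they differ by one that
factors through `Hom(f, x)`, because the dual of an exact sequence of vector spaces is exact. -/
theorem nakayama_exists_desc_of_isColimit {y₁ y₂ : X} {f : y₁ ⟶ y₂} {c : CokernelCofork f}
    (hc : IsColimit c) {z : X} (ψ : (nakayamaFunctor k X).obj y₂ ⟶ z)
    (hψ : (nakayamaFunctor k X).map f ≫ ψ = 0) :
    ∃ ψ' : (nakayamaFunctor k X).obj c.pt ⟶ z, (nakayamaFunctor k X).map c.π ≫ ψ' = ψ := by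
  have hinj (x : X) : Function.Injective (Linear.leftComp k x c.π) := fun g g' h =>
    Cofork.IsColimit.hom_ext hc h
  have hexact (x : X) : LinearMap.ker (Linear.leftComp k x f) =
      LinearMap.range (Linear.leftComp k x c.π) := by
    ext g
    constructor
    · intro hg
      exact ⟨hc.desc (CokernelCofork.ofπ g hg), hc.fac (CokernelCofork.ofπ g hg) .one⟩
    · rintro ⟨g, rfl⟩
      change f ≫ c.π ≫ g = 0
      rw [← Category.assoc, c.condition, zero_comp]
  have hsurj (x : X) (ξ : Module.Dual k (c.pt ⟶ x)) :
      ∃ ζ : Module.Dual k (y₂ ⟶ x), ζ ∘ₗ Linear.leftComp k x c.π = ξ :=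
    LinearMap.dualMap_surjective_of_injective (hinj x) ξ
  have hzero {x : X} (ζ : Module.Dual k (y₂ ⟶ x)) (h : ζ ∘ₗ Linear.leftComp k x c.π = 0) :
      (nakayamaι k y₂).app x ζ ≫ ψ = 0 := by
    have : ζ ∈ LinearMap.range (Linear.leftComp k x f).dualMap := by
      rw [LinearMap.range_dualMap_eq_dualAnnihilator_ker, hexact,
        ← LinearMap.ker_dualMap_eq_dualAnnihilator_range]
      exact h
    obtain ⟨ζ', rfl⟩ := this
    have h' := nakayamaι_map f x ζ'
    change (nakayamaι k y₂).app x (ζ' ∘ₗ _) ≫ ψ = 0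
    rw [← h', Category.assoc, hψ, comp_zero]
  have heq {x : X} (ζ ζ' : Module.Dual k (y₂ ⟶ x))
      (h : ζ ∘ₗ Linear.leftComp k x c.π = ζ' ∘ₗ Linear.leftComp k x c.π) :
      (nakayamaι k y₂).app x ζ ≫ ψ = (nakayamaι k y₂).app x ζ' ≫ ψ := by
    rw [← sub_eq_zero, ← Preadditive.sub_comp, ← map_sub]
    exact hzero _ (by rw [LinearMap.sub_comp, h, sub_self])
  -- the choice of the extensions `s x ξ` does not matter, by `heq`
  choose s hs using hsurj
  let φ : DualHomFamily k c.pt z :=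
    { app x :=
        { toFun ξ := (nakayamaι k y₂).app x (s x ξ) ≫ ψ
          map_add' ξ ξ' := by
            rw [← Preadditive.add_comp, ← map_add]
            exact heq _ _ (by rw [LinearMap.add_comp, hs, hs, hs])
          map_smul' a ξ := by
            rw [RingHom.id_apply, ← Linear.smul_comp, ← map_smul]
            exact heq _ _ (by rw [LinearMap.smul_comp, hs, hs]) }
      app_comp {x x'} g ξ := by
        change (nakayamaι k y₂).app x _ ≫ ψ = g ≫ (nakayamaι k y₂).app x' _ ≫ ψ
        rw [reassoc_of% comp_nakayamaι]
        refine heq _ _ ?_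
        rw [hs]
        conv_lhs => rw [← hs x' ξ]
        ext h
        simp }
  refine ⟨nakayamaDesc φ, nakayama_hom_ext fun x ξ => ?_⟩
  rw [reassoc_of% nakayamaι_map, nakayamaι_desc]
  exact heq _ _ (hs _ _)

theorem nakayama_map_cancel {y₁ y₂ : X} {f : y₁ ⟶ y₂} {c : CokernelCofork f}
    (hc : IsColimit c) {z : X} {ψ ψ' : (nakayamaFunctor k X).obj c.pt ⟶ z}
    (h : (nakayamaFunctor k X).map c.π ≫ ψ = (nakayamaFunctor k X).map c.π ≫ ψ') : ψ = ψ' := by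
  refine nakayama_hom_ext fun x ξ => ?_
  have hinj : Function.Injective (Linear.leftComp k x c.π) := fun g g' h =>
    Cofork.IsColimit.hom_ext hc h
  obtain ⟨ζ, rfl⟩ := LinearMap.dualMap_surjective_of_injective hinj ξ
  change (nakayamaι k c.pt).app x (ζ ∘ₗ _) ≫ ψ = (nakayamaι k c.pt).app x (ζ ∘ₗ _) ≫ ψ'
  rw [← nakayamaι_map, Category.assoc, h, Category.assoc]

theorem nakayama_preservesCokernel {y₁ y₂ : X} (f : y₁ ⟶ y₂) :
    PreservesColimit (parallelPair f 0) (nakayamaFunctor k X) := by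
  constructor
  intro c hc
  refine ⟨(CokernelCofork.isColimitMapCoconeEquiv c _).symm (CokernelCofork.IsColimit.ofπ _
    (CokernelCofork.map_condition c _)
    (fun ψ hψ => (nakayama_exists_desc_of_isColimit hc ψ hψ).choose)
    (fun ψ hψ => (nakayama_exists_desc_of_isColimit hc ψ hψ).choose_spec)
    (fun ψ hψ ψ' h => nakayama_map_cancel hc (h.trans
      (nakayama_exists_desc_of_isColimit hc ψ hψ).choose_spec.symm)))⟩

instance : PreservesFiniteColimits (nakayamaFunctor k X) := by
  have := IsFiniteLinear.hasFiniteColimits k (X := X)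
  have := IsFiniteLinear.hasFiniteBiproducts k (X := X)
  have := hasBinaryBiproducts_of_finite_biproducts X
  have := fun {y₁ y₂ : X} (f : y₁ ⟶ y₂) => nakayama_preservesCokernel (k := k) f
  exact Functor.preservesFiniteColimits_of_preservesCokernels _

end NakayamaFunctor

/-! ### The Nakayama functor and adjunctions -/

section Intertwiner

universe v u

variable (k : Type w) [Field k] {X : Type u} [Category.{v} X] [Preadditive X] [Linear k X]

/-- The transposition `Hom(y, H x) → Hom(G y, x)` for an adjunction `G ⊣ H`, as a linear map. -/
def adjunctionTranspose {G H : X ⥤ X} (adj : G ⊣ H) [G.Additive] [G.Linear k] (y x : X) :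
    (y ⟶ H.obj x) →ₗ[k] (G.obj y ⟶ x) where
  toFun h := G.map h ≫ adj.counit.app x
  map_add' := by simp
  map_smul' := by simp [Functor.map_smul]

@[simp]
theorem adjunctionTranspose_apply {G H : X ⥤ X} (adj : G ⊣ H) [G.Additive] [G.Linear k] {y x : X}
    (h : y ⟶ H.obj x) : adjunctionTranspose k adj y x h = G.map h ≫ adj.counit.app x := rfl

variable [IsFiniteLinear k X] [∀ y : X, HasCoend ((nakayamaIntegrand k X).obj y)]

variable {G H K : X ⥤ X} (adj₁ : G ⊣ H) (adj₂ : H ⊣ K) [G.Additive] [G.Linear k] [K.Additive]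
  [K.Linear k]

/-- The canonical morphism `N (G y) ⟶ K (N y)` for adjunctions `G ⊣ H ⊣ K`. In terms of the
universal family it sends `ξ ∈ Hom(G y, x)^*` to the adjunct `x ⟶ K (N y)` of the morphism
`H x ⟶ N y` that belongs to the functional on `Hom(y, H x)` corresponding to `ξ`. -/
noncomputable def nakayamaIntertwinerApp (y : X) :
    (nakayamaFunctor k X).obj (G.obj y) ⟶ K.obj ((nakayamaFunctor k X).obj y) :=
  nakayamaDesc
    { app x :=
        { toFun ξ := adj₂.unit.app x ≫
            K.map ((nakayamaι k y).app (H.obj x) (ξ ∘ₗ adjunctionTranspose k adj₁ y x))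
          map_add' ξ ξ' := by rw [LinearMap.add_comp, map_add, K.map_add, Preadditive.comp_add]
          map_smul' c ξ := by
            rw [LinearMap.smul_comp, map_smul, K.map_smul, Linear.comp_smul, RingHom.id_apply] }
      app_comp {x x'} g ξ := by
        dsimp only [LinearMap.coe_mk, AddHom.coe_mk]
        rw [← adj₂.unit_naturality_assoc, ← K.map_comp, comp_nakayamaι]
        congr 3
        ext h
        simp }

theorem nakayamaι_intertwinerApp (y x : X) (ξ : Module.Dual k (G.obj y ⟶ x)) :
    (nakayamaι k (G.obj y)).app x ξ ≫ nakayamaIntertwinerApp k adj₁ adj₂ y =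
      adj₂.unit.app x ≫
        K.map ((nakayamaι k y).app (H.obj x) (ξ ∘ₗ adjunctionTranspose k adj₁ y x)) :=
  nakayamaι_desc _ _ _

theorem nakayamaIntertwinerApp_naturality {y y' : X} (f : y ⟶ y') :
    (nakayamaFunctor k X).map (G.map f) ≫ nakayamaIntertwinerApp k adj₁ adj₂ y' =
      nakayamaIntertwinerApp k adj₁ adj₂ y ≫ K.map ((nakayamaFunctor k X).map f) := by
  refine nakayama_hom_ext fun x ξ => ?_
  rw [reassoc_of% nakayamaι_map, nakayamaι_intertwinerApp, reassoc_of% nakayamaι_intertwinerApp,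
    ← K.map_comp, nakayamaι_map]
  congr 3
  ext h
  simp

variable {G' H' K' : X ⥤ X} (adj₁' : G' ⊣ H') (adj₂' : H' ⊣ K') [G'.Additive] [G'.Linear k]
  [K'.Additive] [K'.Linear k]

/-- The morphisms `N (G y) ⟶ K (N y)` are compatible with a transformation `τ : G ⟶ G'`, its
conjugate `σ : H' ⟶ H`, and the conjugate `κ : K ⟶ K'` of `σ`. -/
theorem nakayamaIntertwinerApp_conjugate {τ : G ⟶ G'} {σ : H' ⟶ H} {κ : K ⟶ K'}
    (hσ : conjugateEquiv adj₁' adj₁ τ = σ) (hκ : conjugateEquiv adj₂ adj₂' σ = κ) (y : X) :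
    (nakayamaFunctor k X).map (τ.app y) ≫ nakayamaIntertwinerApp k adj₁' adj₂' y =
      nakayamaIntertwinerApp k adj₁ adj₂ y ≫ κ.app _ := by
  refine nakayama_hom_ext fun x ξ => ?_
  rw [reassoc_of% nakayamaι_map, nakayamaι_intertwinerApp, reassoc_of% nakayamaι_intertwinerApp,
    κ.naturality, ← hκ, ← Category.assoc, unit_conjugateEquiv, Category.assoc, ← K'.map_comp,
    comp_nakayamaι]
  congr 3
  ext h
  have h₁ := conjugateEquiv_counit adj₁' adj₁ τ x
  rw [hσ] at h₁
  simp [h₁]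

theorem nakayamaIntertwinerApp_comp (y : X) :
    nakayamaIntertwinerApp k (adj₁.comp adj₁') (adj₂'.comp adj₂) y =
      nakayamaIntertwinerApp k adj₁' adj₂' (G.obj y) ≫
        K'.map (nakayamaIntertwinerApp k adj₁ adj₂ y) := by
  refine nakayama_hom_ext fun x ξ => ?_
  refine (nakayamaι_intertwinerApp k (adj₁.comp adj₁') (adj₂'.comp adj₂) y x ξ).trans ?_
  refine Eq.trans ?_
    ((reassoc_of% (nakayamaι_intertwinerApp k adj₁' adj₂' (G.obj y) x ξ)) _).symm
  rw [← K'.map_comp, nakayamaι_intertwinerApp, K'.map_comp]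
  simp only [Adjunction.comp_unit_app, Category.assoc, Functor.comp_map, Functor.comp_obj]
  congr 5
  ext h
  simp

theorem nakayamaIntertwinerApp_id (y : X) :
    nakayamaIntertwinerApp k (Adjunction.id (C := X)) Adjunction.id y = 𝟙 _ := by
  refine nakayama_hom_ext fun x ξ => ?_
  refine (nakayamaι_intertwinerApp k (Adjunction.id (C := X)) Adjunction.id y x ξ).trans ?_
  rw [Category.comp_id]
  refine (Category.id_comp _).trans ?_
  change (nakayamaι k y).app x _ = (nakayamaι k y).app x ξ
  congr 1
  ext h
  exact congrArg ξ (Category.comp_id h)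

/-- If `K` has a right adjoint `L`, then `K` preserves the coend `N y`, and `N (G y) ⟶ K (N y)` is
an isomorphism. -/
theorem isIso_nakayamaIntertwinerApp {L : X ⥤ X} (adj₃ : K ⊣ L) [H.Additive] [H.Linear k]
    [L.Additive] [L.Linear k] (y : X) : IsIso (nakayamaIntertwinerApp k adj₁ adj₂ y) := by
  -- the inverse is the adjunct, under `K ⊣ L`, of the morphism `N y ⟶ L (N (G y))` that restricts
  -- functionals along the maps `T x` below
  let T (x : X) : (G.obj y ⟶ K.obj x) →ₗ[k] (y ⟶ x) :=
    { toFun h := adj₁.unit.app y ≫ H.map h ≫ adj₂.counit.app x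
      map_add' := by simp
      map_smul' := by simp [Functor.map_smul] }
  let φ : DualHomFamily k y (L.obj ((nakayamaFunctor k X).obj (G.obj y))) :=
    { app x :=
        { toFun ξ := adj₃.unit.app x ≫ L.map ((nakayamaι k (G.obj y)).app (K.obj x) (ξ ∘ₗ T x))
          map_add' ξ ξ' := by rw [LinearMap.add_comp, map_add, L.map_add, Preadditive.comp_add]
          map_smul' c ξ := by
            rw [LinearMap.smul_comp, map_smul, L.map_smul, Linear.comp_smul, RingHom.id_apply] }
      app_comp {x x'} g ξ := by
        dsimp only [LinearMap.coe_mk, AddHom.coe_mk]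
        rw [← adj₃.unit_naturality_assoc, ← L.map_comp, comp_nakayamaι]
        congr 3
        ext h
        simp [T] }
  let κ : K.obj ((nakayamaFunctor k X).obj y) ⟶ (nakayamaFunctor k X).obj (G.obj y) :=
    (adj₃.homEquiv _ _).symm (nakayamaDesc φ)
  have hκ (x : X) (ξ : Module.Dual k (y ⟶ x)) : K.map ((nakayamaι k y).app x ξ) ≫ κ =
      (nakayamaι k (G.obj y)).app (K.obj x) (ξ ∘ₗ T x) := by
    rw [← adj₃.homEquiv_naturality_left_symm, nakayamaι_desc, Equiv.symm_apply_eq,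
      Adjunction.homEquiv_unit]
    rfl
  refine ⟨κ, nakayama_hom_ext fun x ξ => ?_, ?_⟩
  · rw [reassoc_of% nakayamaι_intertwinerApp, hκ, comp_nakayamaι, Category.comp_id]
    congr 1
    ext h
    simp [T]
  · apply (adj₃.homEquiv _ _).injective
    refine nakayama_hom_ext fun x ξ => ?_
    rw [← adj₃.homEquiv_naturality_left, ← adj₃.homEquiv_naturality_left, ← Category.assoc, hκ,
      Category.comp_id, nakayamaι_intertwinerApp]
    have e : K.map ((nakayamaι k y).app x ξ) = adj₂.unit.app (K.obj x) ≫
        K.map (adj₂.counit.app x ≫ (nakayamaι k y).app x ξ) := by simp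
    have e' := comp_nakayamaι (k := k) (adj₂.counit.app x : (K ⋙ H).obj x ⟶ x) ξ
    rw [e]
    refine congrArg (fun t => adj₃.homEquiv _ _ (adj₂.unit.app (K.obj x) ≫ K.map t))
      (Eq.trans ?_ e'.symm)
    refine congrArg ((nakayamaι k y).app (H.obj (K.obj x))) (LinearMap.ext fun h => ?_)
    simp [T]

end Intertwiner

/-! ### Conjugate transformations -/

section Conjugate

universe v u v' u'

/-- Conjugate transformations are recognized by means of the counits. -/
theorem conjugateEquiv_eq_of_counit {C : Type u} {D : Type u'} [Category.{v} C] [Category.{v'} D]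
    {L₁ L₂ : C ⥤ D} {R₁ R₂ : D ⥤ C} (adj₁ : L₁ ⊣ R₁) (adj₂ : L₂ ⊣ R₂) {τ : L₂ ⟶ L₁}
    {σ : R₁ ⟶ R₂}
    (h : ∀ d, L₂.map (σ.app d) ≫ adj₂.counit.app d = τ.app _ ≫ adj₁.counit.app d) :
    conjugateEquiv adj₁ adj₂ τ = σ := by
  ext d
  apply (adj₂.homEquiv _ _).symm.injective
  rw [Adjunction.homEquiv_counit, Adjunction.homEquiv_counit, h, conjugateEquiv_counit]

theorem conjugateEquiv_inv_eq {C : Type u} {D : Type u'} [Category.{v} C] [Category.{v'} D]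
    {L₁ L₂ : C ⥤ D} {R₁ R₂ : D ⥤ C} (adj₁ : L₁ ⊣ R₁) (adj₂ : L₂ ⊣ R₂) {τ : L₂ ≅ L₁}
    {σ : R₁ ≅ R₂} (h : conjugateEquiv adj₁ adj₂ τ.hom = σ.hom) :
    conjugateEquiv adj₂ adj₁ τ.inv = σ.inv := by
  rw [← cancel_epi σ.hom, σ.hom_inv_id, ← h, conjugateEquiv_comp, τ.inv_hom_id, conjugateEquiv_id]

end Conjugate

/-! ### Duals acting from the left -/

section LeftActionAdjunction

open scoped MonoidalLeftAction

universe v u v' u'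

variable {C : Type u} [Category.{v} C] [MonoidalCategory C]
variable (D : Type u') [Category.{v'} D] [MonoidalLeftAction C D]

namespace CategoryTheory.MonoidalCategory.MonoidalLeftAction

variable {D}

theorem associator_hom_actionHomLeft (c₁ c₂ c₃ : C) (d : D) :
    (α_ c₁ c₂ c₃).hom ⊵ₗ d = (αₗ (c₁ ⊗ c₂ : C) c₃ d).hom ≫ (αₗ c₁ c₂ (c₃ ⊙ₗ d)).hom ≫
      c₁ ⊴ₗ (αₗ c₂ c₃ d).inv ≫ (αₗ c₁ (c₂ ⊗ c₃) d).inv := by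
  rw [← cancel_mono (αₗ c₁ (c₂ ⊗ c₃) d).hom, ← cancel_mono (c₁ ⊴ₗ (αₗ c₂ c₃ d).hom)]
  simp

theorem associator_inv_actionHomLeft (c₁ c₂ c₃ : C) (d : D) :
    (α_ c₁ c₂ c₃).inv ⊵ₗ d = (αₗ c₁ (c₂ ⊗ c₃) d).hom ≫ c₁ ⊴ₗ (αₗ c₂ c₃ d).hom ≫
      (αₗ c₁ c₂ (c₃ ⊙ₗ d)).inv ≫ (αₗ (c₁ ⊗ c₂ : C) c₃ d).inv := by
  rw [← cancel_epi ((α_ c₁ c₂ c₃).hom ⊵ₗ d), hom_inv_actionHomLeft]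
  simp

theorem leftUnitor_inv_actionHomLeft (c : C) (d : D) :
    (λ_ c).inv ⊵ₗ d = (λₗ (c ⊙ₗ d)).inv ≫ (αₗ _ _ _).inv := by
  rw [← cancel_epi ((λ_ c).hom ⊵ₗ d), hom_inv_actionHomLeft]
  simp

theorem rightUnitor_inv_actionHomLeft (c : C) (d : D) :
    (ρ_ c).inv ⊵ₗ d = c ⊴ₗ (λₗ d).inv ≫ (αₗ _ _ _).inv := by
  rw [← cancel_epi ((ρ_ c).hom ⊵ₗ d), hom_inv_actionHomLeft]
  simp

/-- The morphism `a ⊙ (a' ⊙ d) ⟶ d` induced by the evaluation of an exact pairing. -/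
def dualCounit (a' a : C) [ExactPairing a' a] (d : D) : a ⊙ₗ (a' ⊙ₗ d) ⟶ d :=
  (αₗ a a' d).inv ≫ ε_ a' a ⊵ₗ d ≫ (λₗ d).hom

/-- The morphism `d ⟶ a' ⊙ (a ⊙ d)` induced by the coevaluation of an exact pairing. -/
def dualUnit (a' a : C) [ExactPairing a' a] (d : D) : d ⟶ a' ⊙ₗ (a ⊙ₗ d) :=
  (λₗ d).inv ≫ η_ a' a ⊵ₗ d ≫ (αₗ a' a d).hom

theorem dualCounit_naturality (a' a : C) [ExactPairing a' a] {d d' : D} (f : d ⟶ d') :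
    a ⊴ₗ (a' ⊴ₗ f) ≫ dualCounit a' a d' = dualCounit a' a d ≫ f := by
  have h := action_exchange (ε_ a' a) f
  simp only [tensor_actionHomRight, Category.assoc] at h
  simp only [dualCounit, Category.assoc, actionUnitIso_hom_naturality]
  rw [← reassoc_of% h]
  simp

theorem dualUnit_naturality (a' a : C) [ExactPairing a' a] {d d' : D} (f : d ⟶ d') :
    f ≫ dualUnit a' a d' = dualUnit a' a d ≫ a' ⊴ₗ (a ⊴ₗ f) := by
  have h := action_exchange (η_ a' a) f
  simp only [tensor_actionHomRight] at h
  simp only [dualUnit, Category.assoc]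
  rw [← actionUnitIso_inv_naturality_assoc, reassoc_of% h]
  simp

theorem dualUnit_comp_dualCounit (a' a : C) [ExactPairing a' a] (d : D) :
    a ⊴ₗ dualUnit a' a d ≫ dualCounit a' a (a ⊙ₗ d) = 𝟙 _ := by
  have h := congrArg (fun t => t ⊵ₗ d) (ExactPairing.coevaluation_evaluation a' a)
  simp only [comp_actionHomLeft, whiskerLeft_actionHomLeft, whiskerRight_actionHomLeft,
    associator_inv_actionHomLeft, leftUnitor_inv_actionHomLeft, rightUnitor_actionHom,
    Category.assoc, Iso.inv_hom_id_assoc] at h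
  simp only [dualUnit, dualCounit, actionHomRight_comp, Category.assoc]
  rw [← cancel_epi (a ⊴ₗ (λₗ[C] d).hom), ← cancel_epi (αₗ a (𝟙_ C) d).hom,
    ← cancel_mono (λₗ[C] (a ⊙ₗ d)).inv, ← cancel_mono (αₗ (𝟙_ C) a d).inv]
  simp only [Category.assoc, Iso.hom_inv_id_assoc, actionHomRight_hom_inv_assoc, Category.id_comp]
  exact h

theorem dualUnit_comp_dualCounit' (a' a : C) [ExactPairing a' a] (d : D) :
    dualUnit a' a (a' ⊙ₗ d) ≫ a' ⊴ₗ dualCounit a' a d = 𝟙 _ := by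
  have h := congrArg (fun t => t ⊵ₗ d) (ExactPairing.evaluation_coevaluation a' a)
  simp only [comp_actionHomLeft, whiskerLeft_actionHomLeft, whiskerRight_actionHomLeft,
    associator_hom_actionHomLeft, rightUnitor_inv_actionHomLeft, leftUnitor_actionHom,
    Category.assoc, Iso.inv_hom_id_assoc] at h
  simp only [dualUnit, dualCounit, actionHomRight_comp, Category.assoc]
  rw [← cancel_epi (λₗ[C] (a' ⊙ₗ d)).hom, ← cancel_epi (αₗ (𝟙_ C) a' d).hom,
    ← cancel_mono (a' ⊴ₗ (λₗ[C] d).inv), ← cancel_mono (αₗ a' (𝟙_ C) d).inv]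
  simp only [Category.assoc, Iso.hom_inv_id_assoc, actionHomRight_hom_inv_assoc, Category.id_comp]
  exact h

variable (D)

/-- If `a'` is a left dual of `a`, then acting by `a` is left adjoint to acting by `a'`. -/
@[simps]
def dualAdjunction (a' a : C) [ExactPairing a' a] : actionLeft D a ⊣ actionLeft D a' where
  unit :=
    { app d := dualUnit a' a d
      naturality _ _ f := dualUnit_naturality a' a f }
  counit :=
    { app d := dualCounit a' a d
      naturality _ _ f := dualCounit_naturality a' a f }
  left_triangle_components d := dualUnit_comp_dualCounit a' a d
  right_triangle_components d := dualUnit_comp_dualCounit' a' a d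

/-- The conjugate of the action of `f` is the action of the dual morphism of `f`. -/
theorem conjugateEquiv_dualAdjunction_map (a' b' : C) {a b : C} [ExactPairing a' a]
    [ExactPairing b' b] (f : a ⟶ b) :
    conjugateEquiv (dualAdjunction D b' b) (dualAdjunction D a' a) ((curriedAction C D).map f) =
      (curriedAction C D).map (leftMate a' b' f) := by
  refine conjugateEquiv_eq_of_counit _ _ fun d => ?_
  change a ⊴ₗ (leftMate a' b' f ⊵ₗ d) ≫ dualCounit a' a d = f ⊵ₗ (b' ⊙ₗ d) ≫ dualCounit b' b d
  have h := congrArg (fun t => t ⊵ₗ d) (leftMate_evaluation a' b' f)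
  simp only [comp_actionHomLeft, whiskerLeft_actionHomLeft, whiskerRight_actionHomLeft,
    Category.assoc] at h
  rw [← cancel_epi (αₗ a b' d).hom]
  simp only [dualCounit, reassoc_of% h]

variable {D} in
theorem dualCounit_tensor (a' a b' b : C) [ExactPairing a' a] [ExactPairing b' b] (d : D) :
    (a ⊗ b) ⊴ₗ (αₗ b' a' d).inv ≫ dualCounit (b' ⊗ a') (a ⊗ b) d =
      (αₗ a b _).hom ≫ a ⊴ₗ dualCounit b' b (a' ⊙ₗ d) ≫ dualCounit a' a d := by
  have e : ε_ (b' ⊗ a') (a ⊗ b) = (α_ a b (b' ⊗ a')).hom ≫ a ◁ (α_ b b' a').inv ≫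
      a ◁ (ε_ b' b ▷ a') ≫ a ◁ (λ_ a').hom ≫ ε_ a' a := by
    rw [ExactPairing.tensor_evaluation]
    monoidal
  simp only [dualCounit, e, comp_actionHomLeft,
    whiskerLeft_actionHomLeft, whiskerRight_actionHomLeft, associator_hom_actionHomLeft,
    associator_inv_actionHomLeft, tensor_actionHomRight, leftUnitor_actionHom,
    actionHomRight_comp, Category.assoc, Iso.inv_hom_id_assoc, actionHomRight_inv_hom_assoc]
  rw [← actionHomRight_comp_assoc a, actionHomRight_inv_hom, actionHomRight_id, Category.id_comp]

/-- The associativity constraint of a left action, as an isomorphism of functors. -/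
@[simps!]
def actionLeftTensorIso (a b : C) : actionLeft D (a ⊗ b) ≅ actionLeft D b ⋙ actionLeft D a :=
  NatIso.ofComponents (fun d => αₗ a b d) (fun {d d'} f => by
    change (a ⊗ b) ⊴ₗ f ≫ (αₗ a b d').hom = (αₗ a b d).hom ≫ a ⊴ₗ (b ⊴ₗ f)
    simp)

theorem conjugateEquiv_dualAdjunction_tensor (a' a b' b : C) [ExactPairing a' a]
    [ExactPairing b' b] :
    conjugateEquiv ((dualAdjunction D b' b).comp (dualAdjunction D a' a))
      (dualAdjunction D (b' ⊗ a') (a ⊗ b)) (actionLeftTensorIso D a b).hom =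
      (actionLeftTensorIso D b' a').inv := by
  refine conjugateEquiv_eq_of_counit _ _ fun d => ?_
  refine (dualCounit_tensor a' a b' b d).trans ?_
  simp only [Adjunction.comp_counit_app]
  rfl

theorem conjugateEquiv_dualAdjunction_unit :
    conjugateEquiv Adjunction.id (dualAdjunction D (𝟙_ C) (𝟙_ C)) (actionUnitNatIso C D).hom =
      (actionUnitNatIso C D).inv := by
  refine conjugateEquiv_eq_of_counit _ _ fun d => ?_
  change (𝟙_ C) ⊴ₗ (λₗ d).inv ≫ dualCounit (𝟙_ C) (𝟙_ C) d = (λₗ d).hom ≫ 𝟙 _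
  have e : ε_ (𝟙_ C) (𝟙_ C) = (ρ_ (𝟙_ C)).hom := rfl
  rw [dualCounit, e]
  simp

end CategoryTheory.MonoidalCategory.MonoidalLeftAction

end LeftActionAdjunction

/-! ### Duals acting from the right -/

section RightActionAdjunction

open scoped MonoidalRightAction

universe v u v' u'

variable {C : Type u} [Category.{v} C] [MonoidalCategory C]
variable (D : Type u') [Category.{v'} D] [MonoidalRightAction C D]

namespace CategoryTheory.MonoidalCategory.MonoidalRightAction

variable {D}

theorem actionHomRight_associator_hom (c₁ c₂ c₃ : C) (d : D) :
    d ⊴ᵣ (α_ c₁ c₂ c₃).hom = (αᵣ d (c₁ ⊗ c₂ : C) c₃).hom ≫ (αᵣ d c₁ c₂).hom ⊵ᵣ c₃ ≫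
      (αᵣ (d ⊙ᵣ c₁ : D) c₂ c₃).inv ≫ (αᵣ d c₁ (c₂ ⊗ c₃)).inv := by
  rw [← cancel_mono (αᵣ d c₁ (c₂ ⊗ c₃)).hom, ← cancel_mono (αᵣ (d ⊙ᵣ c₁ : D) c₂ c₃).hom]
  simp

theorem actionHomRight_associator_inv (c₁ c₂ c₃ : C) (d : D) :
    d ⊴ᵣ (α_ c₁ c₂ c₃).inv = (αᵣ d c₁ (c₂ ⊗ c₃)).hom ≫ (αᵣ (d ⊙ᵣ c₁ : D) c₂ c₃).hom ≫
      (αᵣ d c₁ c₂).inv ⊵ᵣ c₃ ≫ (αᵣ d (c₁ ⊗ c₂ : C) c₃).inv := by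
  rw [← cancel_epi (d ⊴ᵣ (α_ c₁ c₂ c₃).hom), actionHomRight_hom_inv]
  simp

theorem actionHomRight_leftUnitor_inv (c : C) (d : D) :
    d ⊴ᵣ (λ_ c).inv = (ρᵣ d).inv ⊵ᵣ c ≫ (αᵣ _ _ _).inv := by
  rw [← cancel_epi (d ⊴ᵣ (λ_ c).hom), actionHomRight_hom_inv]
  simp

theorem actionHomRight_rightUnitor_inv (c : C) (d : D) :
    d ⊴ᵣ (ρ_ c).inv = (ρᵣ (d ⊙ᵣ c)).inv ≫ (αᵣ _ _ _).inv := by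
  rw [← cancel_epi (d ⊴ᵣ (ρ_ c).hom), actionHomRight_hom_inv]
  simp

/-- The morphism `(d ⊙ b') ⊙ b ⟶ d` induced by the evaluation of an exact pairing. -/
def dualCounit (b b' : C) [ExactPairing b b'] (d : D) : (d ⊙ᵣ b') ⊙ᵣ b ⟶ d :=
  (αᵣ d b' b).inv ≫ d ⊴ᵣ ε_ b b' ≫ (ρᵣ d).hom

/-- The morphism `d ⟶ (d ⊙ b) ⊙ b'` induced by the coevaluation of an exact pairing. -/
def dualUnit (b b' : C) [ExactPairing b b'] (d : D) : d ⟶ (d ⊙ᵣ b) ⊙ᵣ b' :=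
  (ρᵣ d).inv ≫ d ⊴ᵣ η_ b b' ≫ (αᵣ d b b').hom

theorem dualCounit_naturality (b b' : C) [ExactPairing b b'] {d d' : D} (f : d ⟶ d') :
    (f ⊵ᵣ b') ⊵ᵣ b ≫ dualCounit b b' d' = dualCounit b b' d ≫ f := by
  have h := action_exchange f (ε_ b b')
  simp only [actionHomLeft_tensor, Category.assoc] at h
  simp only [dualCounit, Category.assoc, actionUnitIso_hom_naturality]
  rw [reassoc_of% h]
  simp

theorem dualUnit_naturality (b b' : C) [ExactPairing b b'] {d d' : D} (f : d ⟶ d') :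
    f ≫ dualUnit b b' d' = dualUnit b b' d ≫ (f ⊵ᵣ b) ⊵ᵣ b' := by
  have h := action_exchange f (η_ b b')
  simp only [actionHomLeft_tensor] at h
  simp only [dualUnit, Category.assoc]
  rw [← actionUnitIso_inv_naturality_assoc, ← reassoc_of% h]
  simp

theorem dualUnit_comp_dualCounit (b b' : C) [ExactPairing b b'] (d : D) :
    dualUnit b b' d ⊵ᵣ b ≫ dualCounit b b' (d ⊙ᵣ b) = 𝟙 _ := by
  have h := congrArg (fun t => d ⊴ᵣ t) (ExactPairing.evaluation_coevaluation b b')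
  simp only [actionHomRight_comp, actionHomRight_whiskerRight, whiskerRight_actionHomLeft,
    actionHomRight_associator_hom, actionHomRight_rightUnitor_inv, actionHom_leftUnitor,
    Category.assoc, Iso.inv_hom_id_assoc] at h
  simp only [dualUnit, dualCounit, comp_actionHomLeft, Category.assoc]
  rw [← cancel_epi ((ρᵣ[C] d).hom ⊵ᵣ b), ← cancel_epi (αᵣ d (𝟙_ C) b).hom,
    ← cancel_mono (ρᵣ[C] (d ⊙ᵣ b)).inv, ← cancel_mono (αᵣ d b (𝟙_ C)).inv]
  simp only [Category.assoc, Iso.hom_inv_id_assoc, hom_inv_actionHomLeft_assoc, Category.id_comp]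
  exact h

theorem dualUnit_comp_dualCounit' (b b' : C) [ExactPairing b b'] (d : D) :
    dualUnit b b' (d ⊙ᵣ b') ≫ dualCounit b b' d ⊵ᵣ b' = 𝟙 _ := by
  have h := congrArg (fun t => d ⊴ᵣ t) (ExactPairing.coevaluation_evaluation b b')
  simp only [actionHomRight_comp, actionHomRight_whiskerRight, whiskerRight_actionHomLeft,
    actionHomRight_associator_inv, actionHomRight_leftUnitor_inv, actionHom_rightUnitor,
    Category.assoc, Iso.inv_hom_id_assoc] at h
  simp only [dualUnit, dualCounit, comp_actionHomLeft, Category.assoc]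
  rw [← cancel_epi (ρᵣ[C] (d ⊙ᵣ b')).hom, ← cancel_epi (αᵣ d b' (𝟙_ C)).hom,
    ← cancel_mono ((ρᵣ[C] d).inv ⊵ᵣ b'), ← cancel_mono (αᵣ d (𝟙_ C) b').inv]
  simp only [Category.assoc, Iso.hom_inv_id_assoc, hom_inv_actionHomLeft_assoc, Category.id_comp]
  exact h

variable (D)

/-- If `b'` is a right dual of `b`, then acting by `b` from the right is left adjoint to acting by
`b'`. -/
@[simps]
def dualAdjunction (b b' : C) [ExactPairing b b'] : actionRight D b ⊣ actionRight D b' where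
  unit :=
    { app d := dualUnit b b' d
      naturality _ _ f := dualUnit_naturality b b' f }
  counit :=
    { app d := dualCounit b b' d
      naturality _ _ f := dualCounit_naturality b b' f }
  left_triangle_components d := dualUnit_comp_dualCounit b b' d
  right_triangle_components d := dualUnit_comp_dualCounit' b b' d

theorem rightMate_evaluation (b' c' : C) {b c : C} [ExactPairing b b'] [ExactPairing c c']
    (f : b ⟶ c) : rightMate b' c' f ▷ b ≫ ε_ b b' = c' ◁ f ≫ ε_ c c' :=
  letI : HasRightDual b := ⟨b'⟩
  letI : HasRightDual c := ⟨c'⟩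
  rightAdjointMate_comp_evaluation f

/-- The conjugate of the action of `f` is the action of the dual morphism of `f`. -/
theorem conjugateEquiv_dualAdjunction_map (b' c' : C) {b c : C} [ExactPairing b b']
    [ExactPairing c c'] (f : b ⟶ c) :
    conjugateEquiv (dualAdjunction D c c') (dualAdjunction D b b') ((curriedAction C D).map f) =
      (curriedAction C D).map (rightMate b' c' f) := by
  refine conjugateEquiv_eq_of_counit _ _ fun d => ?_
  change (d ⊴ᵣ rightMate b' c' f) ⊵ᵣ b ≫ dualCounit b b' d =
    (d ⊙ᵣ c') ⊴ᵣ f ≫ dualCounit c c' d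
  have h := congrArg (fun t => d ⊴ᵣ t) (rightMate_evaluation b' c' f)
  simp only [actionHomRight_comp, actionHomRight_whiskerRight, whiskerRight_actionHomLeft,
    Category.assoc] at h
  rw [← cancel_epi (αᵣ d c' b).hom]
  simp only [dualCounit, reassoc_of% h]

variable {D} in
theorem dualCounit_tensor (b b' c c' : C) [ExactPairing b b'] [ExactPairing c c'] (d : D) :
    (αᵣ d c' b').inv ⊵ᵣ (b ⊗ c) ≫ dualCounit (b ⊗ c) (c' ⊗ b') d =
      (αᵣ _ b c).hom ≫ dualCounit b b' (d ⊙ᵣ c') ⊵ᵣ c ≫ dualCounit c c' d := by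
  have e : ε_ (b ⊗ c) (c' ⊗ b') = (α_ (c' ⊗ b') b c).inv ≫ (α_ c' b' b).hom ▷ c ≫
      (c' ◁ ε_ b b') ▷ c ≫ (ρ_ c').hom ▷ c ≫ ε_ c c' := by
    rw [ExactPairing.tensor_evaluation]
    monoidal
  simp only [dualCounit, e, actionHomRight_comp,
    actionHomRight_whiskerRight, whiskerRight_actionHomLeft, actionHomRight_associator_hom,
    actionHomRight_associator_inv, actionHomLeft_tensor, actionHom_rightUnitor,
    comp_actionHomLeft, Category.assoc, Iso.inv_hom_id_assoc, inv_hom_actionHomLeft_assoc]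
  rw [← comp_actionHomLeft_assoc (z := c), inv_hom_actionHomLeft, id_actionHomLeft,
    Category.id_comp]

/-- The associativity constraint of a right action, as an isomorphism of functors. -/
@[simps!]
def actionRightTensorIso (b c : C) : actionRight D (b ⊗ c) ≅ actionRight D b ⋙ actionRight D c :=
  NatIso.ofComponents (fun d => αᵣ d b c) (fun {d d'} f => by
    change f ⊵ᵣ (b ⊗ c) ≫ (αᵣ d' b c).hom = (αᵣ d b c).hom ≫ (f ⊵ᵣ b) ⊵ᵣ c
    simp)

theorem conjugateEquiv_dualAdjunction_tensor (b b' c c' : C) [ExactPairing b b']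
    [ExactPairing c c'] :
    conjugateEquiv ((dualAdjunction D b b').comp (dualAdjunction D c c'))
      (dualAdjunction D (b ⊗ c) (c' ⊗ b')) (actionRightTensorIso D b c).hom =
      (actionRightTensorIso D c' b').inv := by
  refine conjugateEquiv_eq_of_counit _ _ fun d => ?_
  refine (dualCounit_tensor b b' c c' d).trans ?_
  simp only [Adjunction.comp_counit_app]
  rfl

theorem conjugateEquiv_dualAdjunction_unit :
    conjugateEquiv Adjunction.id (dualAdjunction D (𝟙_ C) (𝟙_ C)) (actionUnitNatIso C D).hom =
      (actionUnitNatIso C D).inv := by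
  refine conjugateEquiv_eq_of_counit _ _ fun d => ?_
  change (ρᵣ d).inv ⊵ᵣ (𝟙_ C) ≫ dualCounit (𝟙_ C) (𝟙_ C) d = (ρᵣ d).hom ≫ 𝟙 _
  have e : ε_ (𝟙_ C) (𝟙_ C) = (λ_ (𝟙_ C)).hom := unitors_equal.symm
  rw [dualCounit, e]
  simp

end CategoryTheory.MonoidalCategory.MonoidalRightAction

end RightActionAdjunction

/-! ### The middle associativity isomorphism and duals -/

section MiddleIso

open scoped MonoidalLeftAction MonoidalRightAction

variable {A : Type u₁} [Category.{v₁} A] [MonoidalCategory A]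
variable {B : Type u₂} [Category.{v₂} B] [MonoidalCategory B]
variable {M : Type u₃} [Category.{v₃} M] [MonoidalLeftAction A M] [MonoidalRightAction B M]
  [MonoidalBiaction A B M]

namespace MonoidalBiaction

theorem middleIso_hom_naturality_left {a a' : A} (f : a ⟶ a') (m : M) (b : B) :
    (f ⊵ₗ m) ⊵ᵣ b ≫ (middleIso a' m b).hom = (middleIso a m b).hom ≫ f ⊵ₗ (m ⊙ᵣ b) := by
  simpa using middleIso_hom_naturality f (𝟙 m) (𝟙 b)

theorem middleIso_hom_naturality_middle (a : A) {m m' : M} (g : m ⟶ m') (b : B) :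
    (a ⊴ₗ g) ⊵ᵣ b ≫ (middleIso a m' b).hom = (middleIso a m b).hom ≫ a ⊴ₗ (g ⊵ᵣ b) := by
  simpa using middleIso_hom_naturality (𝟙 a) g (𝟙 b)

theorem middleIso_hom_naturality_right (a : A) (m : M) {b b' : B} (h : b ⟶ b') :
    (a ⊙ₗ m) ⊴ᵣ h ≫ (middleIso a m b').hom = (middleIso a m b).hom ≫ a ⊴ₗ (m ⊴ᵣ h) := by
  have := middleIso_hom_naturality (𝟙 a) (𝟙 m) h
  rw [MonoidalLeftAction.id_actionHom, MonoidalLeftAction.actionHomRight_id,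
    MonoidalRightAction.id_actionHom, MonoidalRightAction.id_actionHom,
    MonoidalLeftAction.id_actionHom] at this
  exact this

/-- The compatibility of `middleIso` with the unit of the left action follows from the one with its
associativity constraint, as acting by the unit is faithful. -/
theorem middleIso_unit_left (m : M) (b : B) :
    (middleIso (𝟙_ A) m b).hom ≫ (λₗ[A] (m ⊙ᵣ b)).hom = (λₗ[A] m).hom ⊵ᵣ b := by
  have key : (𝟙_ A) ⊴ₗ ((middleIso (𝟙_ A) m b).hom ≫ (λₗ[A] (m ⊙ᵣ b)).hom) =
      (𝟙_ A) ⊴ₗ ((λₗ[A] m).hom ⊵ᵣ b) := by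
    rw [← cancel_epi ((αₗ (𝟙_ A) (𝟙_ A) m).hom ⊵ᵣ b ≫ (middleIso (𝟙_ A) ((𝟙_ A) ⊙ₗ m) b).hom),
      MonoidalLeftAction.actionHomRight_comp, Category.assoc,
      reassoc_of% (middleIso_tensor_left (𝟙_ A) (𝟙_ A) m b),
      ← MonoidalLeftAction.rightUnitor_actionHom, Category.assoc,
      ← middleIso_hom_naturality_middle, ← MonoidalRightAction.comp_actionHomLeft_assoc,
      ← MonoidalLeftAction.rightUnitor_actionHom, middleIso_hom_naturality_left]
  rwa [MonoidalLeftAction.unit_actionHomRight, MonoidalLeftAction.unit_actionHomRight,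
    cancel_epi, cancel_mono] at key

theorem middleIso_unit_right (a : A) (m : M) :
    (middleIso a m (𝟙_ B)).hom ≫ a ⊴ₗ (ρᵣ[B] m).hom = (ρᵣ[B] (a ⊙ₗ m)).hom := by
  have key : ((middleIso a m (𝟙_ B)).hom ≫ a ⊴ₗ (ρᵣ[B] m).hom) ⊵ᵣ (𝟙_ B) =
      (ρᵣ[B] (a ⊙ₗ m)).hom ⊵ᵣ (𝟙_ B) := by
    rw [← cancel_mono (middleIso a m (𝟙_ B)).hom, ← cancel_epi (αᵣ (a ⊙ₗ m) (𝟙_ B) (𝟙_ B)).hom,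
      MonoidalRightAction.comp_actionHomLeft, Category.assoc, middleIso_hom_naturality_middle,
      ← reassoc_of% (middleIso_tensor_right a m (𝟙_ B) (𝟙_ B)),
      ← MonoidalLeftAction.actionHomRight_comp, ← MonoidalRightAction.actionHom_leftUnitor,
      ← MonoidalRightAction.actionHom_leftUnitor_assoc, middleIso_hom_naturality_right]
  rwa [MonoidalRightAction.unit_actionHomRight, MonoidalRightAction.unit_actionHomRight,
    cancel_epi, cancel_mono] at key

theorem dualCounit_actionHomLeft (a' a : A) [ExactPairing a' a] (m : M) (b : B) :
    MonoidalLeftAction.dualCounit a' a m ⊵ᵣ b =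
      (middleIso a (a' ⊙ₗ m) b).hom ≫ a ⊴ₗ (middleIso a' m b).hom ≫
        MonoidalLeftAction.dualCounit a' a (m ⊙ᵣ b) := by
  rw [← cancel_epi ((αₗ a a' m).hom ⊵ᵣ b), reassoc_of% (middleIso_tensor_left a a' m b)]
  simp only [MonoidalLeftAction.dualCounit, Iso.hom_inv_id_assoc,
    ← MonoidalRightAction.comp_actionHomLeft]
  rw [← reassoc_of% middleIso_hom_naturality_left, middleIso_unit_left,
    MonoidalRightAction.comp_actionHomLeft]

theorem middleIso_dualCounit (a : A) (m : M) (b b' : B) [ExactPairing b b'] :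
    (middleIso a m b').hom ⊵ᵣ b ≫ (middleIso a (m ⊙ᵣ b') b).hom ≫
        a ⊴ₗ MonoidalRightAction.dualCounit b b' m =
      MonoidalRightAction.dualCounit b b' (a ⊙ₗ m) := by
  rw [← cancel_epi (αᵣ (a ⊙ₗ m) b' b).hom, ← reassoc_of% (middleIso_tensor_right a m b' b)]
  simp only [MonoidalRightAction.dualCounit, Iso.hom_inv_id_assoc,
    ← MonoidalLeftAction.actionHomRight_comp]
  rw [MonoidalLeftAction.actionHomRight_comp, ← reassoc_of% middleIso_hom_naturality_right,
    middleIso_unit_right]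

variable (M) in
/-- The isomorphisms `(a ⊙ m) ⊙ b ≅ a ⊙ (m ⊙ b)`, as an isomorphism of functors in `m`. -/
@[simps!]
def middleNatIso (a : A) (b : B) :
    MonoidalLeftAction.actionLeft M a ⋙ MonoidalRightAction.actionRight M b ≅
      MonoidalRightAction.actionRight M b ⋙ MonoidalLeftAction.actionLeft M a :=
  NatIso.ofComponents (fun m => middleIso a m b)
    (fun g => middleIso_hom_naturality_middle a g b)

theorem conjugateEquiv_middleNatIso (a' a : A) (b b' : B) [ExactPairing a' a]
    [ExactPairing b b'] :
    conjugateEquiv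
      ((MonoidalRightAction.dualAdjunction M b b').comp (MonoidalLeftAction.dualAdjunction M a' a))
      ((MonoidalLeftAction.dualAdjunction M a' a).comp (MonoidalRightAction.dualAdjunction M b b'))
      (middleNatIso M a b).hom = (middleNatIso M a' b').hom := by
  refine conjugateEquiv_eq_of_counit _ _ fun m => ?_
  rw [Adjunction.comp_counit_app, Adjunction.comp_counit_app]
  change (a ⊴ₗ (middleIso a' m b').hom) ⊵ᵣ b ≫
      MonoidalLeftAction.dualCounit a' a (m ⊙ᵣ b') ⊵ᵣ b ≫ MonoidalRightAction.dualCounit b b' m =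
    (middleIso a ((a' ⊙ₗ m) ⊙ᵣ b') b).hom ≫
      a ⊴ₗ MonoidalRightAction.dualCounit b b' (a' ⊙ₗ m) ≫ MonoidalLeftAction.dualCounit a' a m
  rw [dualCounit_actionHomLeft, Category.assoc, reassoc_of% middleIso_hom_naturality_middle,
    Category.assoc, ← MonoidalLeftAction.dualCounit_naturality,
    ← MonoidalLeftAction.actionHomRight_comp_assoc, ← MonoidalLeftAction.actionHomRight_comp_assoc,
    Category.assoc, middleIso_dualCounit]

end MonoidalBiaction

end MiddleIso

/-! ### The bimodule functor structure -/

section LinearOfOplax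

open scoped MonoidalLeftAction MonoidalRightAction
open Functor.LaxLeftLinear Functor.OplaxLeftLinear Functor.LaxRightLinear Functor.OplaxRightLinear

universe v u

variable {C : Type u} [Category.{v} C] [MonoidalCategory C]
variable {D : Type u₁} [Category.{v₁} D] {D' : Type u₂} [Category.{v₂} D'] (F : D ⥤ D')

/-- An oplax left linear functor with invertible structure morphisms is left linear. -/
noncomputable abbrev CategoryTheory.Functor.LeftLinear.ofOplax [MonoidalLeftAction C D]
    [MonoidalLeftAction C D'] [F.OplaxLeftLinear C] [∀ (c : C) (d : D), IsIso (δₗ F c d)] :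
    F.LeftLinear C where
  μₗ c d := CategoryTheory.inv (δₗ F c d)
  μₗ_naturality_left f d := by
    rw [IsIso.eq_inv_comp, ← δₗ_naturality_left_assoc, IsIso.hom_inv_id, Category.comp_id]
  μₗ_naturality_right c _ _ f := by
    rw [IsIso.eq_inv_comp, ← δₗ_naturality_right_assoc, IsIso.hom_inv_id, Category.comp_id]
  μₗ_associativity c c' d := by
    rw [IsIso.inv_comp_eq, δₗ_associativity_assoc,
      ← MonoidalLeftAction.actionHomRight_comp_assoc, IsIso.hom_inv_id]
    simp
  μₗ_unitality d := by
    rw [IsIso.eq_inv_comp, δₗ_unitality_hom]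
  μₗ_comp_δₗ c d := by simp
  δₗ_comp_μₗ c d := by simp

/-- An oplax right linear functor with invertible structure morphisms is right linear. -/
noncomputable abbrev CategoryTheory.Functor.RightLinear.ofOplax [MonoidalRightAction C D]
    [MonoidalRightAction C D'] [F.OplaxRightLinear C] [∀ (d : D) (c : C), IsIso (δᵣ F d c)] :
    F.RightLinear C where
  μᵣ d c := CategoryTheory.inv (δᵣ F d c)
  μᵣ_naturality_right d _ _ f := by
    rw [IsIso.eq_inv_comp, ← δᵣ_naturality_right_assoc, IsIso.hom_inv_id, Category.comp_id]
  μᵣ_naturality_left f c := by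
    rw [IsIso.eq_inv_comp, ← δᵣ_naturality_left_assoc, IsIso.hom_inv_id, Category.comp_id]
  μᵣ_associativity d c c' := by
    rw [IsIso.inv_comp_eq, δᵣ_associativity_assoc,
      ← MonoidalRightAction.comp_actionHomLeft_assoc, IsIso.hom_inv_id]
    simp
  μᵣ_unitality d := by
    rw [IsIso.eq_inv_comp, δᵣ_unitality_hom]
  μᵣ_comp_δᵣ d c := by simp
  δᵣ_comp_μᵣ d c := by simp

end LinearOfOplax

section NakayamaModule

open scoped MonoidalLeftAction MonoidalRightAction
open MonoidalBiaction (middleIso)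

variable (k : Type w) [Field k]
variable {M : Type u₃} [Category.{v₃} M] [Preadditive M] [Linear k M] [IsFiniteLinear k M]
  [∀ m : M, HasCoend ((nakayamaIntegrand k M).obj m)]

section Left

variable {A : Type u₁} [Category.{v₁} A] [MonoidalCategory A] [MonoidalLeftAction A M]
variable [∀ a : A, (MonoidalLeftAction.actionLeft M a).Additive]
  [∀ a : A, (MonoidalLeftAction.actionLeft M a).Linear k]

/-- The morphism `N (a ⊙ m) ⟶ a'' ⊙ N m`, for a left dual `a'` of `a` and a left dual `a''` of
`a'`. -/
noncomputable def nakayamaLeft (a'' a' a : A) [ExactPairing a'' a'] [ExactPairing a' a] (m : M) :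
    (nakayamaFunctor k M).obj (a ⊙ₗ m) ⟶ a'' ⊙ₗ (nakayamaFunctor k M).obj m :=
  nakayamaIntertwinerApp k (MonoidalLeftAction.dualAdjunction M a' a)
    (MonoidalLeftAction.dualAdjunction M a'' a') m

theorem isIso_nakayamaLeft (a''' a'' a' a : A) [ExactPairing a''' a''] [ExactPairing a'' a']
    [ExactPairing a' a] (m : M) : IsIso (nakayamaLeft k a'' a' a m) :=
  isIso_nakayamaIntertwinerApp k _ _ (MonoidalLeftAction.dualAdjunction M a''' a'') m

theorem nakayamaLeft_naturality_right (a'' a' a : A) [ExactPairing a'' a'] [ExactPairing a' a]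
    {m m' : M} (f : m ⟶ m') :
    (nakayamaFunctor k M).map (a ⊴ₗ f) ≫ nakayamaLeft k a'' a' a m' =
      nakayamaLeft k a'' a' a m ≫ a'' ⊴ₗ (nakayamaFunctor k M).map f :=
  nakayamaIntertwinerApp_naturality k (MonoidalLeftAction.dualAdjunction M a' a)
    (MonoidalLeftAction.dualAdjunction M a'' a') f

theorem nakayamaLeft_naturality_left (a'' a' b'' b' : A) {a b : A} [ExactPairing a'' a']
    [ExactPairing a' a] [ExactPairing b'' b'] [ExactPairing b' b] (f : a ⟶ b) (m : M) :
    (nakayamaFunctor k M).map (f ⊵ₗ m) ≫ nakayamaLeft k b'' b' b m =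
      nakayamaLeft k a'' a' a m ≫ leftMate₂ a'' a' b'' b' f ⊵ₗ (nakayamaFunctor k M).obj m :=
  nakayamaIntertwinerApp_conjugate k _ _ _ _
    (MonoidalLeftAction.conjugateEquiv_dualAdjunction_map M a' b' f)
    (MonoidalLeftAction.conjugateEquiv_dualAdjunction_map M b'' a'' (leftMate a' b' f)) m

theorem nakayamaLeft_tensor (a'' a' a b'' b' b : A) [ExactPairing a'' a']
    [ExactPairing a' a] [ExactPairing b'' b'] [ExactPairing b' b] (m : M) :
    nakayamaLeft k (a'' ⊗ b'') (b' ⊗ a') (a ⊗ b) m ≫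
        (αₗ a'' b'' ((nakayamaFunctor k M).obj m)).hom =
      (nakayamaFunctor k M).map (αₗ a b m).hom ≫ nakayamaLeft k a'' a' a (b ⊙ₗ m) ≫
        a'' ⊴ₗ nakayamaLeft k b'' b' b m := by
  have h := nakayamaIntertwinerApp_conjugate k _ _ _ _
    (MonoidalLeftAction.conjugateEquiv_dualAdjunction_tensor M a' a b' b)
    (conjugateEquiv_inv_eq _ _ (σ := (MonoidalLeftAction.actionLeftTensorIso M a'' b'').symm)
      (MonoidalLeftAction.conjugateEquiv_dualAdjunction_tensor M b'' b' a'' a')) m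
  rw [nakayamaIntertwinerApp_comp] at h
  exact h.symm

theorem nakayamaLeft_unit (m : M) :
    nakayamaLeft k (𝟙_ A) (𝟙_ A) (𝟙_ A) m ≫ (λₗ[A] ((nakayamaFunctor k M).obj m)).hom =
      (nakayamaFunctor k M).map (λₗ[A] m).hom := by
  have h := nakayamaIntertwinerApp_conjugate k _ _ _ _
    (MonoidalLeftAction.conjugateEquiv_dualAdjunction_unit (C := A) M)
    (conjugateEquiv_inv_eq _ _ (σ := (MonoidalLeftAction.actionUnitNatIso A M).symm)
      (MonoidalLeftAction.conjugateEquiv_dualAdjunction_unit (C := A) M)) m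
  rw [nakayamaIntertwinerApp_id] at h
  exact h.symm.trans (Category.comp_id _)

variable [LeftRigidCategory A]

/-- The Nakayama functor as an oplax left linear functor into the twisted category. -/
noncomputable instance nakayamaOplaxLeftLinear :
    (nakayamaFunctor k M ⋙ toDoubleDualTwist M).OplaxLeftLinear A where
  δₗ a m := nakayamaLeft k (leftDualObj (leftDualObj a)) (leftDualObj a) a m
  δₗ_naturality_left f m := nakayamaLeft_naturality_left k _ _ _ _ f m
  δₗ_naturality_right a _ _ f := nakayamaLeft_naturality_right k _ _ a f
  δₗ_associativity a b m := by
    -- the chosen duals of `a ⊗ b` are compared with the products of the duals of `b` and `a`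
    have h := nakayamaLeft_naturality_left k (leftDualObj (leftDualObj (a ⊗ b)))
      (leftDualObj (a ⊗ b)) (leftDualObj (leftDualObj a) ⊗ leftDualObj (leftDualObj b))
      (leftDualObj b ⊗ leftDualObj a) (𝟙 (a ⊗ b)) m
    rw [MonoidalLeftAction.id_actionHomLeft, CategoryTheory.Functor.map_id, Category.id_comp] at h
    have h' := nakayamaLeft_tensor k (leftDualObj (leftDualObj a)) (leftDualObj a) a
      (leftDualObj (leftDualObj b)) (leftDualObj b) b m
    rw [h, Category.assoc] at h'
    exact h'
  δₗ_unitality_inv m := by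
    -- the chosen duals of the unit are compared with the unit itself
    have h := nakayamaLeft_naturality_left k (𝟙_ A) (𝟙_ A)
      (leftDualObj (leftDualObj (𝟙_ A))) (leftDualObj (𝟙_ A)) (𝟙 (𝟙_ A)) m
    rw [MonoidalLeftAction.id_actionHomLeft, CategoryTheory.Functor.map_id, Category.id_comp] at h
    have h' := nakayamaLeft_unit k (A := A) m
    rw [← Iso.eq_comp_inv] at h'
    rw [h', Category.assoc, ← CategoryTheory.Functor.mapIso_hom, ← Iso.inv_comp_eq] at h
    exact h.symm

end Left

section Right

variable {B : Type u₂} [Category.{v₂} B] [MonoidalCategory B] [MonoidalRightAction B M]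
variable [∀ b : B, (MonoidalRightAction.actionRight M b).Additive]
  [∀ b : B, (MonoidalRightAction.actionRight M b).Linear k]

/-- The morphism `N (m ⊙ b) ⟶ N m ⊙ b''`, for a right dual `b'` of `b` and a right dual `b''` of
`b'`. -/
noncomputable def nakayamaRight (b b' b'' : B) [ExactPairing b b'] [ExactPairing b' b''] (m : M) :
    (nakayamaFunctor k M).obj (m ⊙ᵣ b) ⟶ (nakayamaFunctor k M).obj m ⊙ᵣ b'' :=
  nakayamaIntertwinerApp k (MonoidalRightAction.dualAdjunction M b b')
    (MonoidalRightAction.dualAdjunction M b' b'') m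

theorem isIso_nakayamaRight (b b' b'' b''' : B) [ExactPairing b b'] [ExactPairing b' b'']
    [ExactPairing b'' b'''] (m : M) : IsIso (nakayamaRight k b b' b'' m) :=
  isIso_nakayamaIntertwinerApp k _ _ (MonoidalRightAction.dualAdjunction M b'' b''') m

theorem nakayamaRight_naturality_left (b b' b'' : B) [ExactPairing b b'] [ExactPairing b' b'']
    {m m' : M} (f : m ⟶ m') :
    (nakayamaFunctor k M).map (f ⊵ᵣ b) ≫ nakayamaRight k b b' b'' m' =
      nakayamaRight k b b' b'' m ≫ (nakayamaFunctor k M).map f ⊵ᵣ b'' :=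
  nakayamaIntertwinerApp_naturality k (MonoidalRightAction.dualAdjunction M b b')
    (MonoidalRightAction.dualAdjunction M b' b'') f

theorem nakayamaRight_naturality_right (b' b'' c' c'' : B) {b c : B} [ExactPairing b b']
    [ExactPairing b' b''] [ExactPairing c c'] [ExactPairing c' c''] (f : b ⟶ c) (m : M) :
    (nakayamaFunctor k M).map (m ⊴ᵣ f) ≫ nakayamaRight k c c' c'' m =
      nakayamaRight k b b' b'' m ≫ (nakayamaFunctor k M).obj m ⊴ᵣ rightMate₂ b'' b' c'' c' f :=
  nakayamaIntertwinerApp_conjugate k _ _ _ _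
    (MonoidalRightAction.conjugateEquiv_dualAdjunction_map M b' c' f)
    (MonoidalRightAction.conjugateEquiv_dualAdjunction_map M c'' b'' (rightMate b' c' f)) m

theorem nakayamaRight_tensor (b b' b'' c c' c'' : B) [ExactPairing b b']
    [ExactPairing b' b''] [ExactPairing c c'] [ExactPairing c' c''] (m : M) :
    nakayamaRight k (b ⊗ c) (c' ⊗ b') (b'' ⊗ c'') m ≫
        (αᵣ ((nakayamaFunctor k M).obj m) b'' c'').hom =
      (nakayamaFunctor k M).map (αᵣ m b c).hom ≫ nakayamaRight k c c' c'' (m ⊙ᵣ b) ≫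
        nakayamaRight k b b' b'' m ⊵ᵣ c'' := by
  have h := nakayamaIntertwinerApp_conjugate k _ _ _ _
    (MonoidalRightAction.conjugateEquiv_dualAdjunction_tensor M b b' c c')
    (conjugateEquiv_inv_eq _ _ (σ := (MonoidalRightAction.actionRightTensorIso M b'' c'').symm)
      (MonoidalRightAction.conjugateEquiv_dualAdjunction_tensor M c' c'' b' b'')) m
  rw [nakayamaIntertwinerApp_comp] at h
  exact h.symm

theorem nakayamaRight_unit (m : M) :
    nakayamaRight k (𝟙_ B) (𝟙_ B) (𝟙_ B) m ≫ (ρᵣ[B] ((nakayamaFunctor k M).obj m)).hom =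
      (nakayamaFunctor k M).map (ρᵣ[B] m).hom := by
  have h := nakayamaIntertwinerApp_conjugate k _ _ _ _
    (MonoidalRightAction.conjugateEquiv_dualAdjunction_unit (C := B) M)
    (conjugateEquiv_inv_eq _ _ (σ := (MonoidalRightAction.actionUnitNatIso B M).symm)
      (MonoidalRightAction.conjugateEquiv_dualAdjunction_unit (C := B) M)) m
  rw [nakayamaIntertwinerApp_id] at h
  exact h.symm.trans (Category.comp_id _)

variable [RightRigidCategory B]

/-- The Nakayama functor as an oplax right linear functor into the twisted category. -/
noncomputable instance nakayamaOplaxRightLinear :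
    (nakayamaFunctor k M ⋙ toDoubleDualTwist M).OplaxRightLinear B where
  δᵣ m b := nakayamaRight k b (rightDualObj b) (rightDualObj (rightDualObj b)) m
  δᵣ_naturality_right m _ _ f := nakayamaRight_naturality_right k _ _ _ _ f m
  δᵣ_naturality_left f b := nakayamaRight_naturality_left k b _ _ f
  δᵣ_associativity m b c := by
    -- the chosen duals of `b ⊗ c` are compared with the products of the duals of `c` and `b`
    have h := nakayamaRight_naturality_right k (rightDualObj (b ⊗ c))
      (rightDualObj (rightDualObj (b ⊗ c))) (rightDualObj c ⊗ rightDualObj b)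
      (rightDualObj (rightDualObj b) ⊗ rightDualObj (rightDualObj c)) (𝟙 (b ⊗ c)) m
    rw [MonoidalRightAction.actionHomRight_id, CategoryTheory.Functor.map_id, Category.id_comp] at h
    have h' := nakayamaRight_tensor k b (rightDualObj b) (rightDualObj (rightDualObj b))
      c (rightDualObj c) (rightDualObj (rightDualObj c)) m
    rw [h, Category.assoc] at h'
    exact h'
  δᵣ_unitality_inv m := by
    -- the chosen duals of the unit are compared with the unit itself
    have h := nakayamaRight_naturality_right k (𝟙_ B) (𝟙_ B)
      (rightDualObj (𝟙_ B)) (rightDualObj (rightDualObj (𝟙_ B))) (𝟙 (𝟙_ B)) m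
    rw [MonoidalRightAction.actionHomRight_id, CategoryTheory.Functor.map_id, Category.id_comp] at h
    have h' := nakayamaRight_unit k (B := B) m
    rw [← Iso.eq_comp_inv] at h'
    rw [h', Category.assoc, ← CategoryTheory.Functor.mapIso_hom, ← Iso.inv_comp_eq] at h
    exact h.symm

end Right

section Biaction

variable {A : Type u₁} [Category.{v₁} A] [MonoidalCategory A] [MonoidalLeftAction A M]
variable [∀ a : A, (MonoidalLeftAction.actionLeft M a).Additive]
  [∀ a : A, (MonoidalLeftAction.actionLeft M a).Linear k]
variable {B : Type u₂} [Category.{v₂} B] [MonoidalCategory B] [MonoidalRightAction B M]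
variable [∀ b : B, (MonoidalRightAction.actionRight M b).Additive]
  [∀ b : B, (MonoidalRightAction.actionRight M b).Linear k] [MonoidalBiaction A B M]

/-- The two ways `N ((a ⊙ m) ⊙ b) ⟶ a'' ⊙ (N m ⊙ b'')` agree, because the composites of the left
and right adjunctions in either order are related by conjugate middle associativity isomorphisms. -/
theorem nakayama_middleIso (a'' a' a : A) (b b' b'' : B) [ExactPairing a'' a']
    [ExactPairing a' a] [ExactPairing b b'] [ExactPairing b' b''] (m : M) :
    (nakayamaFunctor k M).map (middleIso a m b).hom ≫ nakayamaLeft k a'' a' a (m ⊙ᵣ b) ≫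
        a'' ⊴ₗ nakayamaRight k b b' b'' m =
      nakayamaRight k b b' b'' (a ⊙ₗ m) ≫ nakayamaLeft k a'' a' a m ⊵ᵣ b'' ≫
        (middleIso a'' ((nakayamaFunctor k M).obj m) b'').hom := by
  have h := nakayamaIntertwinerApp_conjugate k _ _ _ _
    (MonoidalBiaction.conjugateEquiv_middleNatIso (M := M) a' a b b')
    (MonoidalBiaction.conjugateEquiv_middleNatIso (M := M) a'' a' b' b'') m
  rw [nakayamaIntertwinerApp_comp, nakayamaIntertwinerApp_comp] at h
  exact h.trans (Category.assoc _ _ _)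

variable (A B M)

/-- The Nakayama functor as a bimodule functor into the twisted category. -/
noncomputable abbrev nakayamaBimoduleFunctor [RigidCategory A] [RigidCategory B] :
    BimoduleFunctor A B (nakayamaFunctor k M ⋙ toDoubleDualTwist M) :=
  haveI : ∀ (a : A) (m : M), IsIso (Functor.OplaxLeftLinear.δₗ
      (nakayamaFunctor k M ⋙ toDoubleDualTwist M) a m) := fun a m =>
    -- a third dual provides the right adjoint needed for invertibility
    isIso_nakayamaLeft k (leftDualObj (leftDualObj (leftDualObj a))) _ _ a m
  haveI : ∀ (m : M) (b : B), IsIso (Functor.OplaxRightLinear.δᵣ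
      (nakayamaFunctor k M ⋙ toDoubleDualTwist M) m b) := fun m b =>
    isIso_nakayamaRight k b _ _ (rightDualObj (rightDualObj (rightDualObj b))) m
  { Functor.LeftLinear.ofOplax (C := A) (nakayamaFunctor k M ⋙ toDoubleDualTwist M),
    Functor.RightLinear.ofOplax (C := B) (nakayamaFunctor k M ⋙ toDoubleDualTwist M) with
    middle_comm a m b := by
      have h := nakayama_middleIso k (leftDualObj (leftDualObj a)) (leftDualObj a) a b
        (rightDualObj b) (rightDualObj (rightDualObj b)) m
      have := isIso_nakayamaLeft k (M := M) (leftDualObj (leftDualObj (leftDualObj a)))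
        (leftDualObj (leftDualObj a)) (leftDualObj a) a
      have := isIso_nakayamaRight k (M := M) b (rightDualObj b) (rightDualObj (rightDualObj b))
        (rightDualObj (rightDualObj (rightDualObj b)))
      -- the actions on the twisted category unfold to actions of the double duals on `M`
      change CategoryTheory.inv (nakayamaLeft k (leftDualObj (leftDualObj a)) (leftDualObj a) a m)
          ⊵ᵣ rightDualObj (rightDualObj b) ≫
        CategoryTheory.inv (nakayamaRight k b (rightDualObj b) (rightDualObj (rightDualObj b))
          (a ⊙ₗ m)) ≫ (nakayamaFunctor k M).map (middleIso a m b).hom =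
        (middleIso (leftDualObj (leftDualObj a)) ((nakayamaFunctor k M).obj m)
          (rightDualObj (rightDualObj b))).hom ≫
        leftDualObj (leftDualObj a) ⊴ₗ CategoryTheory.inv (nakayamaRight k b (rightDualObj b)
          (rightDualObj (rightDualObj b)) m) ≫
        CategoryTheory.inv (nakayamaLeft k (leftDualObj (leftDualObj a)) (leftDualObj a) a
          (m ⊙ᵣ b))
      rw [← MonoidalLeftAction.inv_actionHomRight, ← MonoidalRightAction.inv_actionHomLeft,
        IsIso.inv_comp_eq, IsIso.inv_comp_eq, ← reassoc_of% h]
      simp }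

end Biaction

end NakayamaModule

theorem theorem4p3 (k : Type w) [Field k] [IsAlgClosed k]
    (A : Type u₁) [Category.{v₁} A] [Preadditive A] [Linear k A] [MonoidalCategory A]
    [RigidCategory A] [IsFiniteTensorCategory k A]
    (B : Type u₂) [Category.{v₂} B] [Preadditive B] [Linear k B] [MonoidalCategory B]
    [RigidCategory B] [IsFiniteTensorCategory k B]
    (M : Type u₃) [Category.{v₃} M] [Preadditive M] [Linear k M] [IsFiniteLinear k M]
    [MonoidalLeftAction A M] [MonoidalRightAction B M] [MonoidalBiaction A B M]
    [IsBilinearExactBiaction k A B M] :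
    ∃ _ : ∀ m : M, HasCoend ((nakayamaIntegrand k M).obj m),
      (nakayamaFunctor k M).Additive ∧ (nakayamaFunctor k M).Linear k ∧
      PreservesFiniteColimits (nakayamaFunctor k M) ∧
      Nonempty (BimoduleFunctor A B (nakayamaFunctor k M ⋙ toDoubleDualTwist M)) := by
  have hc : ∀ m : M, HasCoend ((nakayamaIntegrand k M).obj m) := hasCoend_nakayamaIntegrand k
  have := IsBilinearExactBiaction.left_additive (k := k) (A := A) (B := B) (M := M)
  have := IsBilinearExactBiaction.left_linear (k := k) (A := A) (B := B) (M := M)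
  have := IsBilinearExactBiaction.right_additive (k := k) (A := A) (B := B) (M := M)
  have := IsBilinearExactBiaction.right_linear (k := k) (A := A) (B := B) (M := M)
  exact ⟨hc, inferInstance, inferInstance, inferInstance, ⟨nakayamaBimoduleFunctor k M A B⟩⟩
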